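/- **Theorem 2 (reduced matrix element of $t^l_m$ in $V^j(\lambda)$).** Let $\eta\in\mathbb R\setminus\{0\}$, $q=e^{-\eta/2}$, $\gamma=\frac{\cosh(\eta/4)}{\sinh(2\eta)}$, $[n]=\frac{q^{-n/2}-(-1)^nq^{n/2}}{q^{-1/2}+q^{1/2}}$ and $[n]!=[1][2]\cdots[n]$. Let $U_q[osp(1|2)]$ be the $\mathbb Z_2$-graded Hopf algebra over $\mathbb C$ generated by the even elements $H$, $q^{\pm H}$ and the odd elements $v_\pm$ with $q^Hq^{-H}=q^{-H}q^H=1$, $[H,q^H]=0$, $[H,v_\pm]=\pm\frac12v_\pm$, $q^Hv_\pm=q^{\pm1/2}v_\pm q^H$ and $v_+v_-+v_-v_+=-\frac{\sinh(\eta H)}{\sinh(2\eta)}$, where $\sinh(\eta H)=\frac12(q^{-2H}-q^{2H})$, with coproduct $\Delta(H)=H\otimes1+1\otimes H$, $\Delta(q^{\pm H})=q^{\pm H}\otimes q^{\pm H}$, $\Delta(v_\pm)=v_\pm\otimes q^H+q^{-H}\otimes v_\pm$, antipode $S(H)=-H$, $S(q^{\pm H})=q^{\mp H}$, $S(v_\pm)=-q^{\pm1/2}v_\pm$,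 and adjoint action $\mathrm{ad}_a(b)=\sum(-1)^{|a^{(2)}||b|}a^{(1)}b\,S(a^{(2)})$. For a non-negative integer $l$ and $\lambda\in\mathbb Z_2$ let $V^l(\lambda)$ be the graded irreducible representation $\pi^l$ with basis $e^l_m$, $-l\le m\le l$, of degrees $|e^l_m|=l-m+\lambda \bmod 2$, and $$\pi^l(v_+)e^l_m=(-1)^{l-m}([l-m][l+m+1]\gamma)^{1/2}e^l_{m+1},\quad \pi^l(v_-)e^l_m=([l+m][l-m+1]\gamma)^{1/2}e^l_{m-1},\quad \pi^l(H)e^l_m=\tfrac m2e^l_m,\quad \pi^l(q^{\pm H})e^l_m=q^{\pm m/2}e^l_m .$$ The algebra acts on $V^{l_1}(\lambda_1)\otimes V^{l_2}(\lambda_2)$ through $\Delta$, with $(a\otimes b)(v\otimes w)=(-1)^{|b||v|}av\otimes bw$. The Clebsch–Gordan coefficients $(l_1m_1\lambda_1,l_2m_2\lambda_2|lm\lambda)_q$ are the real numbers such that the vectors $e^l_m(l_1,l_2,\lambda)=\sum_{m_1,m_2}(l_1m_1\lambda_1,l_2m_2\lambda_2|lm\lambda)_q\,e^{l_1}_{m_1}\otimes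 e^{l_2}_{m_2}$ are homogeneous of degree $l-m+\lambda$, transform under $v_\pm$, $H$ as the basis $e^l_m$, satisfy $$\sum_{m_1,m_2}(-1)^{(l_1-m_1)(l_2-m_2)}(l_1m_1\lambda_1,l_2m_2\lambda_2|lm\lambda)_q(l_1m_1\lambda_1,l_2m_2\lambda_2|lm'\lambda)_q=(-1)^{(l-m)(l_1+l_2+l)}\delta_{mm'},$$ and have $(l_1l_1\lambda_1,l_2\,l{-}l_1\,\lambda_2|ll\lambda)_q>0$. Put $$[l_1m_1\lambda_1,l_2m_2\lambda_2|lm\lambda]_q=(-1)^{(l_1-m_1)(l_2-m_2)}(-1)^{(l-m)(l_1+l_2+l)}(l_1m_1\lambda_1,l_2m_2\lambda_2|lm\lambda)_q .$$ Let $l\ge0$ be even, let $j\ge0$ be an integer with $l\le2j$, let $\lambda\in\mathbb Z_2$, and for $-l\le p\le l$ let $$t^l_p=\left(\frac{[l+p]!}{[2l]!\,[l-p]!\,\gamma^{l-p}}\right)^{1/2}(\mathrm{ad}_{v_-})^{l-p}\bigl(v_+^l\,q^{lH}\bigr)\in U_q[osp(1|2)].$$ Then for all $-l\le p\le l$ and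 $-j\le m,n\le j$ $$\pi^j(t^l_p)_{mn}=\alpha\,[l\,p\,0,\,j\,n\,\lambda\,|\,j\,m\,\lambda]_q ,$$ where the reduced matrix element $\alpha$ is $$\alpha=(-1)^{\frac12l(l+1)}\,q^{-\frac14l(l+1)}\,\bigl|[l]!\bigr|\left(\frac{[2j+l+1]!\;\gamma^l}{[2l]!\,[2j-l]!\,[2j+1]}\right)^{1/2}$$ (for $\eta>0$ one has $[l]!>0$). -/

import Mathlib

/-! The quantum superalgebra `U_q[osp(1|2)]`, its irreducible representations,
its adjoint action and its Clebsch-Gordan coefficients. -/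

open scoped TensorProduct DirectSum

noncomputable section

namespace UqOsp

/-! ### Scalars -/

/-- The deformation parameter `q = exp (-η / 2)`. -/
def q (η : ℝ) : ℝ := Real.exp (-η / 2)

/-- The super `q`-number
`[n] = (q^(-n/2) - (-1)^n q^(n/2)) / (q^(-1/2) + q^(1/2))`; in particular `[1] = 1`. -/
def qnum (η : ℝ) (n : ℤ) : ℝ :=
  (q η ^ (-(n : ℝ) / 2) - (-1) ^ n * q η ^ ((n : ℝ) / 2)) /
    (q η ^ (-(1 / 2) : ℝ) + q η ^ (1 / 2 : ℝ))

/-- `[n]! = [1] [2] ⋯ [n]`. -/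
def qfact (η : ℝ) (n : ℕ) : ℝ := ∏ k ∈ Finset.range n, qnum η (k + 1)

/-- `γ = ch (η/4) / sh (2η)`. -/
def gam (η : ℝ) : ℝ := Real.cosh (η / 4) / Real.sinh (2 * η)

/-- A real power of `q`, as a complex number. -/
def qpow (η x : ℝ) : ℂ := ((q η ^ x : ℝ) : ℂ)

/-- The sign `(-1)^i` of a parity `i`. -/
def psign (i : ZMod 2) : ℂ := if i = 0 then 1 else -1

lemma q_pos (η : ℝ) : 0 < q η := Real.exp_pos _

lemma q_rpow (η x : ℝ) : q η ^ x = Real.exp (-η * x / 2) := by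
  rw [q, ← Real.exp_mul]; congr 1; ring

lemma qpow_add (η x y : ℝ) : qpow η (x + y) = qpow η x * qpow η y := by
  simp only [qpow, Real.rpow_add (q_pos η)]; push_cast; rfl

lemma qpow_zero (η : ℝ) : qpow η 0 = 1 := by simp [qpow]

lemma qpow_mul_neg (η x : ℝ) : qpow η x * qpow η (-x) = 1 := by
  rw [← qpow_add]; simp [qpow_zero]

lemma qnum_even (η : ℝ) {n : ℤ} (hn : Even n) :
    qnum η n = Real.sinh (η * n / 4) / Real.cosh (η / 4) := by
  rw [qnum, hn.neg_one_zpow]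
  simp only [q_rpow, Real.sinh_eq, Real.cosh_eq]
  rw [div_div_div_cancel_right₀ (by norm_num)]
  congr 1
  · rw [one_mul]; congr 2 <;> ring
  · congr 2 <;> ring

lemma qnum_odd (η : ℝ) {n : ℤ} (hn : Odd n) :
    qnum η n = Real.cosh (η * n / 4) / Real.cosh (η / 4) := by
  rw [qnum, hn.neg_one_zpow]
  simp only [q_rpow, Real.cosh_eq]
  rw [div_div_div_cancel_right₀ (by norm_num)]
  congr 1
  · rw [neg_one_mul, sub_neg_eq_add]; congr 2 <;> ring
  · congr 2 <;> ring

lemma qnum_zero (η : ℝ) : qnum η 0 = 0 := by simp [qnum_even η Even.zero]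

/-! ### The algebra

The generators are `H`, `v₊`, `v₋` and the group-like elements `q^H`, `q^(-H)`, in which
`sh (η H) = (q^(-2H) - q^(2H)) / 2` is expressed. -/

/-- Names of the generators. -/
inductive Gen
  | H
  | K
  | Kinv
  | vp
  | vm

/-- The defining relations: `K = q^H` is invertible, commutes with `H` and satisfies
`q^H v_± = q^(±1/2) v_± q^H`; moreover `[H, v_±] = ±(1/2) v_±` and
`v₊ v₋ + v₋ v₊ = - sh (η H) / sh (2η)`. -/
inductive Rel (η : ℝ) : FreeAlgebra ℂ Gen → FreeAlgebra ℂ Gen → Prop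
  | K_Kinv : Rel η (FreeAlgebra.ι ℂ Gen.K * FreeAlgebra.ι ℂ Gen.Kinv) 1
  | Kinv_K : Rel η (FreeAlgebra.ι ℂ Gen.Kinv * FreeAlgebra.ι ℂ Gen.K) 1
  | H_K : Rel η (FreeAlgebra.ι ℂ Gen.H * FreeAlgebra.ι ℂ Gen.K)
      (FreeAlgebra.ι ℂ Gen.K * FreeAlgebra.ι ℂ Gen.H)
  | H_vp : Rel η (FreeAlgebra.ι ℂ Gen.H * FreeAlgebra.ι ℂ Gen.vp)
      (FreeAlgebra.ι ℂ Gen.vp * FreeAlgebra.ι ℂ Gen.H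
        + (1 / 2 : ℂ) • FreeAlgebra.ι ℂ Gen.vp)
  | H_vm : Rel η (FreeAlgebra.ι ℂ Gen.H * FreeAlgebra.ι ℂ Gen.vm)
      (FreeAlgebra.ι ℂ Gen.vm * FreeAlgebra.ι ℂ Gen.H
        - (1 / 2 : ℂ) • FreeAlgebra.ι ℂ Gen.vm)
  | K_vp : Rel η (FreeAlgebra.ι ℂ Gen.K * FreeAlgebra.ι ℂ Gen.vp)
      (qpow η (1 / 2) • (FreeAlgebra.ι ℂ Gen.vp * FreeAlgebra.ι ℂ Gen.K))
  | K_vm : Rel η (FreeAlgebra.ι ℂ Gen.K * FreeAlgebra.ι ℂ Gen.vm)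
      (qpow η (-(1 / 2)) • (FreeAlgebra.ι ℂ Gen.vm * FreeAlgebra.ι ℂ Gen.K))
  | vp_vm : Rel η
      (FreeAlgebra.ι ℂ Gen.vp * FreeAlgebra.ι ℂ Gen.vm
        + FreeAlgebra.ι ℂ Gen.vm * FreeAlgebra.ι ℂ Gen.vp)
      (-(1 / (2 * Real.sinh (2 * η) : ℂ)) •
        (FreeAlgebra.ι ℂ Gen.Kinv ^ 2 - FreeAlgebra.ι ℂ Gen.K ^ 2))

/-- The quantum superalgebra `U_q[osp(1|2)]`. -/
def U (η : ℝ) : Type := RingQuot (Rel η)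

instance (η : ℝ) : Ring (U η) := inferInstanceAs (Ring (RingQuot (Rel η)))

instance (η : ℝ) : Algebra ℂ (U η) := inferInstanceAs (Algebra ℂ (RingQuot (Rel η)))

/-- The quotient map from the free algebra. -/
def mk (η : ℝ) : FreeAlgebra ℂ Gen →ₐ[ℂ] U η := RingQuot.mkAlgHom ℂ (Rel η)

lemma mk_rel {η : ℝ} {x y : FreeAlgebra ℂ Gen} (h : Rel η x y) : mk η x = mk η y :=
  RingQuot.mkAlgHom_rel ℂ h

variable {η : ℝ}

/-- The generators as elements of the algebra. -/
def gen (η : ℝ) (g : Gen) : U η := mk η (FreeAlgebra.ι ℂ g)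

def H (η : ℝ) : U η := gen η Gen.H

/-- `K = q^H`. -/
def K (η : ℝ) : U η := gen η Gen.K

/-- `Kinv = q^(-H)`. -/
def Kinv (η : ℝ) : U η := gen η Gen.Kinv

def vp (η : ℝ) : U η := gen η Gen.vp

def vm (η : ℝ) : U η := gen η Gen.vm

lemma K_Kinv : K η * Kinv η = 1 := by
  simpa [K, Kinv, gen] using mk_rel (Rel.K_Kinv (η := η))

lemma Kinv_K : Kinv η * K η = 1 := by
  simpa [K, Kinv, gen] using mk_rel (Rel.Kinv_K (η := η))

lemma H_K : H η * K η = K η * H η := by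
  simpa [K, H, gen] using mk_rel (Rel.H_K (η := η))

lemma H_vp : H η * vp η = vp η * H η + (1 / 2 : ℂ) • vp η := by
  simpa [vp, H, gen] using mk_rel (Rel.H_vp (η := η))

lemma H_vm : H η * vm η = vm η * H η - (1 / 2 : ℂ) • vm η := by
  simpa [vm, H, gen] using mk_rel (Rel.H_vm (η := η))

lemma K_vp : K η * vp η = qpow η (1 / 2) • (vp η * K η) := by
  simpa [vp, K, gen] using mk_rel (Rel.K_vp (η := η))

lemma K_vm : K η * vm η = qpow η (-(1 / 2)) • (vm η * K η) := by
  simpa [vm, K, gen] using mk_rel (Rel.K_vm (η := η))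

lemma vp_vm : vp η * vm η + vm η * vp η =
    -(1 / (2 * Real.sinh (2 * η) : ℂ)) • (Kinv η ^ 2 - K η ^ 2) := by
  have h := mk_rel (Rel.vp_vm (η := η))
  rw [map_smul, map_sub, map_add, map_mul, map_mul, map_pow, map_pow] at h
  exact h

/-- The universal property of `U_q[osp(1|2)]`. -/
def lift (η : ℝ) {A : Type*} [Ring A] [Algebra ℂ A] (h k k' p m : A)
    (h1 : k * k' = 1) (h2 : k' * k = 1) (h3 : h * k = k * h)
    (h4 : h * p = p * h + (1 / 2 : ℂ) • p) (h5 : h * m = m * h - (1 / 2 : ℂ) • m)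
    (h6 : k * p = qpow η (1 / 2) • (p * k)) (h7 : k * m = qpow η (-(1 / 2)) • (m * k))
    (h8 : p * m + m * p = -(1 / (2 * Real.sinh (2 * η) : ℂ)) • (k' ^ 2 - k ^ 2)) :
    U η →ₐ[ℂ] A :=
  RingQuot.liftAlgHom (S := ℂ) (s := Rel η) ⟨FreeAlgebra.lift ℂ (fun g => match g with
    | Gen.H => h | Gen.K => k | Gen.Kinv => k' | Gen.vp => p | Gen.vm => m), by
      intro x y hxy
      cases hxy <;> simp only [map_mul, map_add, map_sub, map_smul, map_pow, map_one,
        FreeAlgebra.lift_ι_apply] <;> assumption⟩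

section lift

variable {A : Type*} [Ring A] [Algebra ℂ A] {h k k' p m : A}
    {h1 : k * k' = 1} {h2 : k' * k = 1} {h3 : h * k = k * h}
    {h4 : h * p = p * h + (1 / 2 : ℂ) • p} {h5 : h * m = m * h - (1 / 2 : ℂ) • m}
    {h6 : k * p = qpow η (1 / 2) • (p * k)} {h7 : k * m = qpow η (-(1 / 2)) • (m * k)}
    {h8 : p * m + m * p = -(1 / (2 * Real.sinh (2 * η) : ℂ)) • (k' ^ 2 - k ^ 2)}

@[simp] lemma lift_H : lift η h k k' p m h1 h2 h3 h4 h5 h6 h7 h8 (H η) = h := by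
  refine (RingQuot.liftAlgHom_mkAlgHom_apply _ _ _ _).trans (FreeAlgebra.lift_ι_apply _ _)

@[simp] lemma lift_K : lift η h k k' p m h1 h2 h3 h4 h5 h6 h7 h8 (K η) = k := by
  refine (RingQuot.liftAlgHom_mkAlgHom_apply _ _ _ _).trans (FreeAlgebra.lift_ι_apply _ _)

@[simp] lemma lift_Kinv : lift η h k k' p m h1 h2 h3 h4 h5 h6 h7 h8 (Kinv η) = k' := by
  refine (RingQuot.liftAlgHom_mkAlgHom_apply _ _ _ _).trans (FreeAlgebra.lift_ι_apply _ _)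

@[simp] lemma lift_vp : lift η h k k' p m h1 h2 h3 h4 h5 h6 h7 h8 (vp η) = p := by
  refine (RingQuot.liftAlgHom_mkAlgHom_apply _ _ _ _).trans (FreeAlgebra.lift_ι_apply _ _)

@[simp] lemma lift_vm : lift η h k k' p m h1 h2 h3 h4 h5 h6 h7 h8 (vm η) = m := by
  refine (RingQuot.liftAlgHom_mkAlgHom_apply _ _ _ _).trans (FreeAlgebra.lift_ι_apply _ _)

end lift

lemma hom_ext {A : Type*} [Ring A] [Algebra ℂ A] {f g : U η →ₐ[ℂ] A}
    (hH : f (H η) = g (H η)) (hK : f (K η) = g (K η)) (hK' : f (Kinv η) = g (Kinv η))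
    (hp : f (vp η) = g (vp η)) (hm : f (vm η) = g (vm η)) : f = g := by
  apply RingQuot.ringQuot_ext' (S := ℂ) (s := Rel η)
  apply FreeAlgebra.hom_ext
  funext x
  cases x
  · exact hH
  · exact hK
  · exact hK'
  · exact hp
  · exact hm

/-! ### The grading: `H`, `q^(±H)` are even, `v_±` are odd -/

/-- The parity automorphism `a ↦ (-1)^|a| a`. -/
def par (η : ℝ) : U η →ₐ[ℂ] U η :=
  lift η (H η) (K η) (Kinv η) (-vp η) (-vm η) K_Kinv Kinv_K H_K
    (by rw [mul_neg, H_vp, neg_mul, smul_neg]; abel)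
    (by rw [mul_neg, H_vm, neg_mul, smul_neg]; abel)
    (by rw [mul_neg, K_vp, neg_mul, smul_neg])
    (by rw [mul_neg, K_vm, neg_mul, smul_neg])
    (by rw [neg_mul_neg, neg_mul_neg, vp_vm])

@[simp] lemma par_H : par η (H η) = H η := lift_H

@[simp] lemma par_K : par η (K η) = K η := lift_K

@[simp] lemma par_Kinv : par η (Kinv η) = Kinv η := lift_Kinv

@[simp] lemma par_vp : par η (vp η) = -vp η := lift_vp

@[simp] lemma par_vm : par η (vm η) = -vm η := lift_vm

@[simp] lemma par_par (a : U η) : par η (par η a) = a := by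
  have : (par η).comp (par η) = AlgHom.id ℂ (U η) := by
    apply hom_ext <;> simp
  exact DFunLike.congr_fun this a

/-- The homogeneous elements of degree `i`: the eigenspace of the parity automorphism for
`(-1)^i`. -/
def gr (η : ℝ) (i : ZMod 2) : Submodule ℂ (U η) where
  carrier := {a | par η a = psign i • a}
  add_mem' := by
    intro a b ha hb
    simp only [Set.mem_ofPred_eq] at *
    rw [map_add, ha, hb, smul_add]
  zero_mem' := by simp
  smul_mem' := by
    intro c a ha
    simp only [Set.mem_ofPred_eq] at *
    rw [map_smul, ha, smul_comm]

lemma mem_gr {i : ZMod 2} {a : U η} : a ∈ gr η i ↔ par η a = psign i • a := Iff.rfl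

/-- The even component of an element. -/
def evenPart (η : ℝ) : U η →ₗ[ℂ] U η := (1 / 2 : ℂ) • (LinearMap.id + (par η).toLinearMap)

/-- The odd component of an element. -/
def oddPart (η : ℝ) : U η →ₗ[ℂ] U η := (1 / 2 : ℂ) • (LinearMap.id - (par η).toLinearMap)

lemma evenPart_apply (a : U η) : evenPart η a = (1 / 2 : ℂ) • (a + par η a) := rfl

lemma oddPart_apply (a : U η) : oddPart η a = (1 / 2 : ℂ) • (a - par η a) := rfl

lemma evenPart_mem (a : U η) : evenPart η a ∈ gr η 0 := by
  simp [mem_gr, psign, evenPart_apply, add_comm]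

lemma oddPart_mem (a : U η) : oddPart η a ∈ gr η 1 := by
  rw [mem_gr, oddPart_apply, map_smul, map_sub, par_par, psign, if_neg (by decide),
    neg_one_smul, ← smul_neg, neg_sub]

lemma evenPart_add_oddPart (a : U η) : evenPart η a + oddPart η a = a := by
  rw [evenPart_apply, oddPart_apply, ← smul_add, add_add_sub_cancel, ← two_smul ℂ a, smul_smul]
  norm_num

lemma psign_add (i k : ZMod 2) : psign (i + k) = psign i * psign k := by
  have h : ∀ i : ZMod 2, i = 0 ∨ i = 1 := by decide
  have h2 : (1 + 1 : ZMod 2) = 0 := by decide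
  rcases h i with rfl | rfl <;> rcases h k with rfl | rfl <;> simp [psign, h2]

lemma evenPart_of_mem_zero {a : U η} (ha : a ∈ gr η 0) : evenPart η a = a := by
  rw [mem_gr] at ha
  rw [evenPart_apply, ha, psign, if_pos rfl, one_smul, ← two_smul ℂ a, smul_smul]
  norm_num

lemma oddPart_of_mem_zero {a : U η} (ha : a ∈ gr η 0) : oddPart η a = 0 := by
  rw [mem_gr] at ha
  rw [oddPart_apply, ha, psign, if_pos rfl, one_smul, sub_self, smul_zero]

lemma evenPart_of_mem_one {a : U η} (ha : a ∈ gr η 1) : evenPart η a = 0 := by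
  rw [mem_gr] at ha
  simp [evenPart_apply, ha, psign]

lemma oddPart_of_mem_one {a : U η} (ha : a ∈ gr η 1) : oddPart η a = a := by
  rw [mem_gr] at ha
  rw [oddPart_apply, ha, psign, if_neg (by decide), neg_one_smul, sub_neg_eq_add,
    ← two_smul ℂ a, smul_smul]
  norm_num

instance : SetLike.GradedMonoid (gr η) where
  one_mem := by simp [mem_gr, psign]
  mul_mem := by
    intro i k a b ha hb
    rw [mem_gr] at *
    rw [map_mul, ha, hb, smul_mul_smul_comm, psign_add]

instance : DirectSum.Decomposition (gr η) where
  decompose' a := DirectSum.of (fun i => gr η i) 0 ⟨evenPart η a, evenPart_mem a⟩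
    + DirectSum.of (fun i => gr η i) 1 ⟨oddPart η a, oddPart_mem a⟩
  left_inv a := by simp [evenPart_add_oddPart]
  right_inv x := by
    induction x using DirectSum.induction_on with
    | zero =>
      simp only [map_zero]
      have h0 : (⟨0, (gr η 0).zero_mem⟩ : gr η 0) = 0 := rfl
      have h1 : (⟨0, (gr η 1).zero_mem⟩ : gr η 1) = 0 := rfl
      rw [h0, h1, map_zero, map_zero, add_zero]
    | of i x =>
      obtain ⟨x, hx⟩ := x
      simp only [DirectSum.coeAddMonoidHom_of]
      fin_cases i
      · have h0 : (⟨evenPart η x, evenPart_mem x⟩ : gr η 0) = ⟨x, hx⟩ :=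
          Subtype.ext (evenPart_of_mem_zero hx)
        have h1 : (⟨oddPart η x, oddPart_mem x⟩ : gr η 1) = 0 :=
          Subtype.ext (oddPart_of_mem_zero hx)
        rw [h0, h1, map_zero, add_zero]
        rfl
      · have h0 : (⟨evenPart η x, evenPart_mem x⟩ : gr η 0) = 0 :=
          Subtype.ext (evenPart_of_mem_one hx)
        have h1 : (⟨oddPart η x, oddPart_mem x⟩ : gr η 1) = ⟨x, hx⟩ :=
          Subtype.ext (oddPart_of_mem_one hx)
        rw [h0, h1, map_zero, zero_add]
        rfl
    | add x y hx hy =>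
      conv_rhs => rw [← hx, ← hy]
      rw [add_add_add_comm, ← map_add, ← map_add]
      have h0 : ∀ a b : U η, (⟨evenPart η (a + b), evenPart_mem _⟩ : gr η 0) =
          ⟨evenPart η a, evenPart_mem a⟩ + ⟨evenPart η b, evenPart_mem b⟩ :=
        fun a b => Subtype.ext (map_add _ a b)
      have h1 : ∀ a b : U η, (⟨oddPart η (a + b), oddPart_mem _⟩ : gr η 1) =
          ⟨oddPart η a, oddPart_mem a⟩ + ⟨oddPart η b, oddPart_mem b⟩ :=
        fun a b => Subtype.ext (map_add _ a b)
      rw [← h0, ← h1]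
      simp only [map_add]

instance : GradedAlgebra (gr η) where

lemma H_mem : H η ∈ gr η 0 := by simp [mem_gr, psign]

lemma K_mem : K η ∈ gr η 0 := by simp [mem_gr, psign]

lemma Kinv_mem : Kinv η ∈ gr η 0 := by simp [mem_gr, psign]

lemma vp_mem : vp η ∈ gr η 1 := by simp [mem_gr, psign]

lemma vm_mem : vm η ∈ gr η 1 := by simp [mem_gr, psign]

/-! ### The Hopf structure and the adjoint action -/

/-- The algebra `U ⊗ U` with the multiplication
`(a ⊗ b) (c ⊗ d) = (-1)^(|c| |b|) (a c) ⊗ (b d)`. -/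
abbrev UU (η : ℝ) : Type := (gr η) ᵍ⊗[ℂ] (gr η)

lemma gtmul_add (a b c : U η) :
    (a ᵍ⊗ₜ[ℂ] (b + c) : UU η) = (a ᵍ⊗ₜ[ℂ] b : UU η) + (a ᵍ⊗ₜ[ℂ] c : UU η) :=
  TensorProduct.tmul_add a b c

lemma add_gtmul (a b c : U η) :
    ((a + b) ᵍ⊗ₜ[ℂ] c : UU η) = (a ᵍ⊗ₜ[ℂ] c : UU η) + (b ᵍ⊗ₜ[ℂ] c : UU η) :=
  TensorProduct.add_tmul a b c

lemma gtmul_sub (a b c : U η) :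
    (a ᵍ⊗ₜ[ℂ] (b - c) : UU η) = (a ᵍ⊗ₜ[ℂ] b : UU η) - (a ᵍ⊗ₜ[ℂ] c : UU η) :=
  TensorProduct.tmul_sub a b c

lemma sub_gtmul (a b c : U η) :
    ((a - b) ᵍ⊗ₜ[ℂ] c : UU η) = (a ᵍ⊗ₜ[ℂ] c : UU η) - (b ᵍ⊗ₜ[ℂ] c : UU η) :=
  TensorProduct.sub_tmul a b c

lemma smul_gtmul (z : ℂ) (a b : U η) :
    ((z • a) ᵍ⊗ₜ[ℂ] b : UU η) = z • (a ᵍ⊗ₜ[ℂ] b : UU η) :=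
  TensorProduct.smul_tmul' z a b

lemma gtmul_smul (z : ℂ) (a b : U η) :
    (a ᵍ⊗ₜ[ℂ] (z • b) : UU η) = z • (a ᵍ⊗ₜ[ℂ] b : UU η) :=
  TensorProduct.tmul_smul z a b

lemma tmul_mul_of_even_left (a b c d : U η) (hc : c ∈ gr η 0) :
    (a ᵍ⊗ₜ[ℂ] b : UU η) * (c ᵍ⊗ₜ[ℂ] d : UU η) = ((a * c) ᵍ⊗ₜ[ℂ] (b * d) : UU η) := by
  rw [← evenPart_add_oddPart b, gtmul_add, add_mul, add_mul, gtmul_add]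
  have h1 := GradedTensorProduct.tmul_coe_mul_coe_tmul (R := ℂ) (gr η) (gr η) a
    ⟨evenPart η b, evenPart_mem b⟩ ⟨c, hc⟩ d
  have h2 := GradedTensorProduct.tmul_coe_mul_coe_tmul (R := ℂ) (gr η) (gr η) a
    ⟨oddPart η b, oddPart_mem b⟩ ⟨c, hc⟩ d
  simp only [mul_zero, uzpow_zero, one_smul] at h1 h2
  rw [h1, h2]

lemma tmul_mul_of_even_right (a b c d : U η) (hb : b ∈ gr η 0) :
    (a ᵍ⊗ₜ[ℂ] b : UU η) * (c ᵍ⊗ₜ[ℂ] d : UU η) = ((a * c) ᵍ⊗ₜ[ℂ] (b * d) : UU η) := by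
  rw [← evenPart_add_oddPart c, add_gtmul, mul_add, mul_add, add_gtmul]
  have h1 := GradedTensorProduct.tmul_coe_mul_coe_tmul (R := ℂ) (gr η) (gr η) a
    ⟨b, hb⟩ ⟨evenPart η c, evenPart_mem c⟩ d
  have h2 := GradedTensorProduct.tmul_coe_mul_coe_tmul (R := ℂ) (gr η) (gr η) a
    ⟨b, hb⟩ ⟨oddPart η c, oddPart_mem c⟩ d
  simp only [zero_mul, uzpow_zero, one_smul] at h1 h2
  rw [h1, h2]

lemma tmul_mul_of_odd (a b c d : U η) (hb : b ∈ gr η 1) (hc : c ∈ gr η 1) :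
    (a ᵍ⊗ₜ[ℂ] b : UU η) * (c ᵍ⊗ₜ[ℂ] d : UU η) = -((a * c) ᵍ⊗ₜ[ℂ] (b * d) : UU η) := by
  have h1 := GradedTensorProduct.tmul_coe_mul_coe_tmul (R := ℂ) (gr η) (gr η) a
    ⟨b, hb⟩ ⟨c, hc⟩ d
  simp only [mul_one, uzpow_one, Units.neg_smul, one_smul] at h1
  exact h1

lemma H_Kinv : H η * Kinv η = Kinv η * H η := by
  calc H η * Kinv η = Kinv η * (K η * H η) * Kinv η := by
        rw [← mul_assoc, Kinv_K, one_mul]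
    _ = Kinv η * H η * (K η * Kinv η) := by rw [← H_K]; simp only [mul_assoc]
    _ = Kinv η * H η := by rw [K_Kinv, mul_one]

lemma Kinv_vp : Kinv η * vp η = qpow η (-(1 / 2)) • (vp η * Kinv η) := by
  have h : vp η * Kinv η = qpow η (1 / 2) • (Kinv η * vp η) := by
    calc vp η * Kinv η = Kinv η * (K η * vp η) * Kinv η := by
          rw [← mul_assoc, Kinv_K, one_mul]
      _ = qpow η (1 / 2) • (Kinv η * vp η * (K η * Kinv η)) := by
          rw [K_vp]; simp only [mul_assoc, mul_smul_comm, smul_mul_assoc]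
      _ = _ := by rw [K_Kinv, mul_one]
  rw [h, smul_smul, mul_comm, qpow_mul_neg, one_smul]

lemma Kinv_vm : Kinv η * vm η = qpow η (1 / 2) • (vm η * Kinv η) := by
  have h : vm η * Kinv η = qpow η (-(1 / 2)) • (Kinv η * vm η) := by
    calc vm η * Kinv η = Kinv η * (K η * vm η) * Kinv η := by
          rw [← mul_assoc, Kinv_K, one_mul]
      _ = qpow η (-(1 / 2)) • (Kinv η * vm η * (K η * Kinv η)) := by
          rw [K_vm]; simp only [mul_assoc, mul_smul_comm, smul_mul_assoc]
      _ = _ := by rw [K_Kinv, mul_one]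
  rw [h, smul_smul, qpow_mul_neg, one_smul]

/-- The comultiplication: `Δ H = H ⊗ 1 + 1 ⊗ H`, `Δ v_± = v_± ⊗ q^H + q^(-H) ⊗ v_±` and
`Δ q^(±H) = q^(±H) ⊗ q^(±H)`. -/
def comul (η : ℝ) : U η →ₐ[ℂ] UU η :=
  lift η (H η ᵍ⊗ₜ[ℂ] 1 + 1 ᵍ⊗ₜ[ℂ] H η) (K η ᵍ⊗ₜ[ℂ] K η) (Kinv η ᵍ⊗ₜ[ℂ] Kinv η)
    (vp η ᵍ⊗ₜ[ℂ] K η + Kinv η ᵍ⊗ₜ[ℂ] vp η) (vm η ᵍ⊗ₜ[ℂ] K η + Kinv η ᵍ⊗ₜ[ℂ] vm η)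
    (by rw [tmul_mul_of_even_left _ _ _ _ Kinv_mem, K_Kinv]; rfl)
    (by rw [tmul_mul_of_even_left _ _ _ _ K_mem, Kinv_K]; rfl)
    (by
      have h1 : (1 : U η) ∈ gr η 0 := SetLike.GradedOne.one_mem
      rw [add_mul, mul_add, tmul_mul_of_even_left _ _ _ _ K_mem,
        tmul_mul_of_even_left _ _ _ _ K_mem, tmul_mul_of_even_left _ _ _ _ H_mem,
        tmul_mul_of_even_left _ _ _ _ h1, H_K]
      simp only [one_mul, mul_one])
    (by
      have h1 : (1 : U η) ∈ gr η 0 := SetLike.GradedOne.one_mem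
      rw [add_mul, mul_add, mul_add, mul_add, add_mul, add_mul,
        tmul_mul_of_even_right _ _ _ _ h1, tmul_mul_of_even_right _ _ _ _ h1,
        tmul_mul_of_even_right _ _ _ _ H_mem, tmul_mul_of_even_right _ _ _ _ H_mem,
        tmul_mul_of_even_left _ _ _ _ H_mem, tmul_mul_of_even_left _ _ _ _ H_mem,
        tmul_mul_of_even_left _ _ _ _ h1, tmul_mul_of_even_left _ _ _ _ h1,
        H_vp, H_K, H_Kinv]
      simp only [one_mul, mul_one, add_gtmul, gtmul_add, smul_gtmul, gtmul_smul, smul_add]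
      abel)
    (by
      have h1 : (1 : U η) ∈ gr η 0 := SetLike.GradedOne.one_mem
      rw [add_mul, mul_add, mul_add, mul_add, add_mul, add_mul,
        tmul_mul_of_even_right _ _ _ _ h1, tmul_mul_of_even_right _ _ _ _ h1,
        tmul_mul_of_even_right _ _ _ _ H_mem, tmul_mul_of_even_right _ _ _ _ H_mem,
        tmul_mul_of_even_left _ _ _ _ H_mem, tmul_mul_of_even_left _ _ _ _ H_mem,
        tmul_mul_of_even_left _ _ _ _ h1, tmul_mul_of_even_left _ _ _ _ h1,
        H_vm, H_K, H_Kinv]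
      simp only [one_mul, mul_one, sub_gtmul, gtmul_sub, smul_gtmul, gtmul_smul, smul_add]
      abel)
    (by
      rw [mul_add, add_mul, tmul_mul_of_even_right _ _ _ _ K_mem,
        tmul_mul_of_even_right _ _ _ _ K_mem, tmul_mul_of_even_left _ _ _ _ K_mem,
        tmul_mul_of_even_left _ _ _ _ K_mem, K_vp, K_Kinv, Kinv_K]
      simp only [smul_gtmul, gtmul_smul, smul_add])
    (by
      rw [mul_add, add_mul, tmul_mul_of_even_right _ _ _ _ K_mem,
        tmul_mul_of_even_right _ _ _ _ K_mem, tmul_mul_of_even_left _ _ _ _ K_mem,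
        tmul_mul_of_even_left _ _ _ _ K_mem, K_vm, K_Kinv, Kinv_K]
      simp only [smul_gtmul, gtmul_smul, smul_add])
    (by
      have e : ∀ a b : U η, (a ᵍ⊗ₜ[ℂ] (K η * K η) : UU η) + b ᵍ⊗ₜ[ℂ] (K η * K η)
          = (a + b) ᵍ⊗ₜ[ℂ] (K η * K η) := fun a b => (add_gtmul _ _ _).symm
      have e' : ∀ a b : U η, ((Kinv η * Kinv η) ᵍ⊗ₜ[ℂ] a : UU η) + (Kinv η * Kinv η) ᵍ⊗ₜ[ℂ] b
          = (Kinv η * Kinv η) ᵍ⊗ₜ[ℂ] (a + b) := fun a b => (gtmul_add _ _ _).symm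
      have c1 : ((vp η * Kinv η) ᵍ⊗ₜ[ℂ] (K η * vm η) : UU η) =
          (Kinv η * vp η) ᵍ⊗ₜ[ℂ] (vm η * K η) := by
        rw [Kinv_vp, K_vm, gtmul_smul, smul_gtmul]
      have c2 : ((vm η * Kinv η) ᵍ⊗ₜ[ℂ] (K η * vp η) : UU η) =
          (Kinv η * vm η) ᵍ⊗ₜ[ℂ] (vp η * K η) := by
        rw [Kinv_vm, K_vp, gtmul_smul, smul_gtmul]
      rw [add_mul, mul_add, mul_add, add_mul, mul_add, mul_add,
        tmul_mul_of_even_right _ _ _ _ K_mem, tmul_mul_of_even_right _ _ _ _ K_mem,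
        tmul_mul_of_even_right _ _ _ _ K_mem, tmul_mul_of_even_right _ _ _ _ K_mem,
        tmul_mul_of_even_left _ _ _ _ Kinv_mem, tmul_mul_of_even_left _ _ _ _ Kinv_mem,
        tmul_mul_of_odd _ _ _ _ vp_mem vm_mem, tmul_mul_of_odd _ _ _ _ vm_mem vp_mem, c1, c2]
      rw [pow_two, pow_two, tmul_mul_of_even_left _ _ _ _ Kinv_mem,
        tmul_mul_of_even_left _ _ _ _ K_mem]
      rw [show ∀ a b c d e f : UU η, a + b + (-c + d) + (e + c + (-b + f)) = (a + e) + (d + f)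
        from fun a b c d e f => by abel, e, e', vp_vm]
      simp only [smul_gtmul, gtmul_smul, sub_gtmul, gtmul_sub, pow_two, ← smul_add]
      congr 1
      abel)

@[simp] lemma comul_H : comul η (H η) = H η ᵍ⊗ₜ[ℂ] 1 + 1 ᵍ⊗ₜ[ℂ] H η := lift_H

@[simp] lemma comul_K : comul η (K η) = K η ᵍ⊗ₜ[ℂ] K η := lift_K

@[simp] lemma comul_Kinv : comul η (Kinv η) = Kinv η ᵍ⊗ₜ[ℂ] Kinv η := lift_Kinv

@[simp] lemma comul_vp : comul η (vp η) = vp η ᵍ⊗ₜ[ℂ] K η + Kinv η ᵍ⊗ₜ[ℂ] vp η := lift_vp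

@[simp] lemma comul_vm : comul η (vm η) = vm η ᵍ⊗ₜ[ℂ] K η + Kinv η ᵍ⊗ₜ[ℂ] vm η := lift_vm

open MulOpposite in
/-- The anti-homomorphism `a ↦ i^|a| S(a)`, where `S` is the antipode. -/
def antiAux (η : ℝ) : U η →ₐ[ℂ] (U η)ᵐᵒᵖ :=
  lift η (op (-H η)) (op (Kinv η)) (op (K η))
    (op (-(Complex.I * qpow η (1 / 2)) • vp η)) (op (-(Complex.I * qpow η (-(1 / 2))) • vm η))
    (by rw [← op_mul, K_Kinv, op_one])
    (by rw [← op_mul, Kinv_K, op_one])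
    (by rw [← op_mul, ← op_mul, mul_neg, neg_mul, H_Kinv])
    (by
      rw [← op_mul, ← op_mul, ← op_smul, ← op_add, mul_neg, neg_mul, mul_smul_comm, H_vp,
        smul_mul_assoc, smul_add, smul_comm (1 / 2 : ℂ)]
      congr 1
      abel)
    (by
      rw [← op_mul, ← op_mul, ← op_smul, ← op_sub, mul_neg, neg_mul, mul_smul_comm, H_vm,
        smul_mul_assoc, smul_sub, smul_comm (1 / 2 : ℂ)]
      congr 1
      abel)
    (by
      rw [← op_mul, ← op_mul, ← op_smul, mul_smul_comm, smul_mul_assoc, Kinv_vp,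
        smul_comm (qpow η (1 / 2)), smul_smul (qpow η (1 / 2)), qpow_mul_neg, one_smul])
    (by
      rw [← op_mul, ← op_mul, ← op_smul, mul_smul_comm, smul_mul_assoc, Kinv_vm,
        smul_comm (qpow η (-(1 / 2))), smul_smul (qpow η (-(1 / 2))), mul_comm (qpow η (-(1 / 2))),
        qpow_mul_neg, one_smul])
    (by
      rw [← op_mul, ← op_mul, ← op_pow, ← op_pow, ← op_sub, ← op_smul, ← op_add,
        smul_mul_smul_comm, smul_mul_smul_comm]
      have h1 : -(Complex.I * qpow η (-(1 / 2))) * -(Complex.I * qpow η (1 / 2)) = -1 := by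
        linear_combination (qpow η (1 / 2) * qpow η (-(1 / 2))) * Complex.I_mul_I
          - qpow_mul_neg η (1 / 2)
      have h2 : -(Complex.I * qpow η (1 / 2)) * -(Complex.I * qpow η (-(1 / 2))) = -1 := by
        linear_combination (qpow η (1 / 2) * qpow η (-(1 / 2))) * Complex.I_mul_I
          - qpow_mul_neg η (1 / 2)
      rw [h1, h2, ← smul_add, add_comm (vm η * vp η), vp_vm, neg_one_smul, ← smul_neg, neg_sub])

/-- The antipode: the linear map with `S(a b) = (-1)^(|a| |b|) S(b) S(a)` on homogeneous elements,
`S(H) = -H`, `S(q^(±H)) = q^(∓H)` and `S(v_±) = -q^(±1/2) v_±`. -/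
def antipode (η : ℝ) : U η →ₗ[ℂ] U η :=
  (MulOpposite.opLinearEquiv ℂ).symm.toLinearMap ∘ₗ (antiAux η).toLinearMap ∘ₗ
    (evenPart η - Complex.I • oddPart η)

lemma antipode_of_even {a : U η} (ha : a ∈ gr η 0) :
    antipode η a = (antiAux η a).unop := by
  simp [antipode, evenPart_of_mem_zero ha, oddPart_of_mem_zero ha]

lemma antipode_of_odd {a : U η} (ha : a ∈ gr η 1) :
    antipode η a = -Complex.I • (antiAux η a).unop := by
  simp [antipode, evenPart_of_mem_one ha, oddPart_of_mem_one ha]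

@[simp] lemma antipode_H : antipode η (H η) = -H η := by
  rw [antipode_of_even H_mem, antiAux, lift_H, MulOpposite.unop_op]

@[simp] lemma antipode_K : antipode η (K η) = Kinv η := by
  rw [antipode_of_even K_mem, antiAux, lift_K, MulOpposite.unop_op]

@[simp] lemma antipode_Kinv : antipode η (Kinv η) = K η := by
  rw [antipode_of_even Kinv_mem, antiAux, lift_Kinv, MulOpposite.unop_op]

@[simp] lemma antipode_vp : antipode η (vp η) = -qpow η (1 / 2) • vp η := by
  rw [antipode_of_odd vp_mem, antiAux, lift_vp, MulOpposite.unop_op, smul_smul]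
  congr 1
  linear_combination (qpow η (1 / 2)) * Complex.I_mul_I

@[simp] lemma antipode_vm : antipode η (vm η) = -qpow η (-(1 / 2)) • vm η := by
  rw [antipode_of_odd vm_mem, antiAux, lift_vm, MulOpposite.unop_op, smul_smul]
  congr 1
  linear_combination (qpow η (-(1 / 2))) * Complex.I_mul_I

lemma antipode_mul {i k : ZMod 2} {a b : U η} (ha : a ∈ gr η i) (hb : b ∈ gr η k) :
    antipode η (a * b) = psign (i * k) • (antipode η b * antipode η a) := by
  have h : ∀ i : ZMod 2, i = 0 ∨ i = 1 := by decide
  have hab : a * b ∈ gr η (i + k) := SetLike.GradedMul.mul_mem ha hb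
  rcases h i with rfl | rfl <;> rcases h k with rfl | rfl
  · rw [antipode_of_even ha, antipode_of_even hb, antipode_of_even (by simpa using hab)]
    simp [psign]
  · rw [antipode_of_even ha, antipode_of_odd hb, antipode_of_odd (by simpa using hab)]
    simp [psign]
  · rw [antipode_of_odd ha, antipode_of_even hb, antipode_of_odd (by simpa using hab)]
    simp [psign]
  · rw [antipode_of_odd ha, antipode_of_odd hb, antipode_of_even
      (by rw [show (0 : ZMod 2) = 1 + 1 by decide]; exact hab), smul_mul_smul_comm, smul_smul,
      map_mul, MulOpposite.unop_mul, psign, if_neg (by decide)]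
    rw [neg_mul_neg, Complex.I_mul_I, neg_one_mul, neg_neg, one_smul]

/-- For `x = ∑ a₁ ⊗ a₂`, the map `b ↦ ∑ (-1)^(|a₂| |b|) a₁ b S(a₂)`. The sum is split
according to the parity of `a₂`, and `par` is `b ↦ (-1)^|b| b`. -/
def adTensor (η : ℝ) : U η ⊗[ℂ] U η →ₗ[ℂ] Module.End ℂ (U η) :=
  TensorProduct.lift (LinearMap.mk₂ ℂ
    (fun a₁ a₂ => LinearMap.mulLeft ℂ a₁ ∘ₗ
      (LinearMap.mulRight ℂ (antipode η (evenPart η a₂))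
        + LinearMap.mulRight ℂ (antipode η (oddPart η a₂)) ∘ₗ (par η).toLinearMap))
    (fun a a' b => by ext x; simp [add_mul])
    (fun c a b => by ext x; simp)
    (fun a b b' => by ext x; simp [mul_add]; abel)
    (fun c a b => by ext x; simp [mul_add]))

/-- The adjoint action `ad_a (b) = ∑ (-1)^(|a₂| |b|) a₁ b S(a₂)`, where `Δ a = ∑ a₁ ⊗ a₂`. -/
def ad (η : ℝ) (a : U η) : Module.End ℂ (U η) :=
  adTensor η ((GradedTensorProduct.of ℂ (gr η) (gr η)).symm (comul η a))

lemma ad_vm (b : U η) : ad η (vm η) b =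
    vm η * b * Kinv η - qpow η (-(1 / 2)) • (Kinv η * par η b * vm η) := by
  simp [ad, adTensor, evenPart_of_mem_zero K_mem, oddPart_of_mem_zero K_mem,
    evenPart_of_mem_one vm_mem, oddPart_of_mem_one vm_mem, mul_assoc, sub_eq_add_neg]

/-! ### The irreducible representations -/

/-- The index set `{-l, …, l}`. -/
abbrev Weight (l : ℕ) : Type := Set.Icc (-(l : ℤ)) (l : ℤ)

/-- The space `V^l`, of dimension `2l + 1`. -/
abbrev V (l : ℕ) : Type := Weight l → ℂ

/-- The basis vector `e_m` of `V^l`, with `e_m = 0` for `m` outside `{-l, …, l}`. -/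
def e (l : ℕ) (m : ℤ) : V l := fun k => if (k : ℤ) = m then 1 else 0

/-- The linear map with `e_m ↦ c m • e_(m + s)`. -/
def shift (l : ℕ) (s : ℤ) (c : ℤ → ℂ) : Module.End ℂ (V l) :=
  (Pi.basisFun ℂ (Weight l)).constr ℂ (fun m => c m • e l (m + s))

lemma e_coe (l : ℕ) (m : Weight l) : e l m = Pi.basisFun ℂ (Weight l) m := by
  ext k
  simp [e, Pi.single_apply, Subtype.ext_iff]

lemma e_of_not_mem {l : ℕ} {m : ℤ} (hm : ¬ (-(l : ℤ) ≤ m ∧ m ≤ l)) : e l m = 0 := by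
  ext k
  have : (k : ℤ) ≠ m := by rintro rfl; exact hm k.2
  simp [e, this]

lemma shift_e {l : ℕ} {s : ℤ} {c : ℤ → ℂ}
    (h : ∀ m : ℤ, ¬ (-(l : ℤ) ≤ m ∧ m ≤ l) → -(l : ℤ) ≤ m + s ∧ m + s ≤ l → c m = 0) (m : ℤ) :
    shift l s c (e l m) = c m • e l (m + s) := by
  by_cases hm : -(l : ℤ) ≤ m ∧ m ≤ l
  · have := e_coe l ⟨m, hm⟩
    simp only at this
    rw [this, shift, Module.Basis.constr_basis]
  · rw [e_of_not_mem hm, map_zero]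
    by_cases hs : -(l : ℤ) ≤ m + s ∧ m + s ≤ l
    · rw [h m hm hs, zero_smul]
    · rw [e_of_not_mem hs, smul_zero]

/-- The coefficient `(-1)^(l-m) ([l-m][l+m+1]γ)^(1/2)` of `v₊`. -/
def cplus (η : ℝ) (l : ℕ) (m : ℤ) : ℝ :=
  (-1) ^ ((l : ℤ) - m) * √(qnum η (l - m) * qnum η (l + m + 1) * gam η)

/-- The coefficient `([l+m][l-m+1]γ)^(1/2)` of `v₋`. -/
def cminus (η : ℝ) (l : ℕ) (m : ℤ) : ℝ :=
  √(qnum η (l + m) * qnum η (l - m + 1) * gam η)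

/-- `v₊ e_m = (-1)^(l-m) ([l-m][l+m+1]γ)^(1/2) e_(m+1)`. -/
def vpOp (η : ℝ) (l : ℕ) : Module.End ℂ (V l) := shift l 1 (fun m => (cplus η l m : ℂ))

/-- `v₋ e_m = ([l+m][l-m+1]γ)^(1/2) e_(m-1)`. -/
def vmOp (η : ℝ) (l : ℕ) : Module.End ℂ (V l) := shift l (-1) (fun m => (cminus η l m : ℂ))

/-- `H e_m = (m/2) e_m`. -/
def HOp (l : ℕ) : Module.End ℂ (V l) := shift l 0 (fun m => (m : ℂ) / 2)

/-- `q^H e_m = q^(m/2) e_m`. -/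
def KOp (η : ℝ) (l : ℕ) : Module.End ℂ (V l) := shift l 0 (fun m => qpow η ((m : ℝ) / 2))

/-- `q^(-H) e_m = q^(-m/2) e_m`. -/
def KinvOp (η : ℝ) (l : ℕ) : Module.End ℂ (V l) := shift l 0 (fun m => qpow η (-((m : ℝ) / 2)))

lemma vpOp_e (η : ℝ) (l : ℕ) (m : ℤ) : vpOp η l (e l m) = (cplus η l m : ℂ) • e l (m + 1) := by
  refine shift_e ?_ m
  intro k h1 h2
  have : (l : ℤ) + k + 1 = 0 := by omega
  simp [cplus, this, qnum_zero]

lemma vmOp_e (η : ℝ) (l : ℕ) (m : ℤ) : vmOp η l (e l m) = (cminus η l m : ℂ) • e l (m - 1) := by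
  refine shift_e ?_ m
  intro k h1 h2
  have : (l : ℤ) - k + 1 = 0 := by omega
  simp [cminus, this, qnum_zero]

lemma diag_e (l : ℕ) (c : ℤ → ℂ) (m : ℤ) : shift l 0 c (e l m) = c m • e l m := by
  have := shift_e (l := l) (s := 0) (c := c) (by intro k h1 h2; simp at h2; omega) m
  rwa [add_zero] at this

lemma HOp_e (l : ℕ) (m : ℤ) : HOp l (e l m) = ((m : ℂ) / 2) • e l m := diag_e _ _ _

lemma KOp_e (η : ℝ) (l : ℕ) (m : ℤ) : KOp η l (e l m) = qpow η ((m : ℝ) / 2) • e l m :=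
  diag_e _ _ _

lemma KinvOp_e (η : ℝ) (l : ℕ) (m : ℤ) : KinvOp η l (e l m) = qpow η (-((m : ℝ) / 2)) • e l m :=
  diag_e _ _ _

lemma end_ext {l : ℕ} {f g : Module.End ℂ (V l)}
    (h : ∀ m : ℤ, -(l : ℤ) ≤ m → m ≤ l → f (e l m) = g (e l m)) : f = g := by
  refine (Pi.basisFun ℂ (Weight l)).ext (fun m => ?_)
  rw [← e_coe]
  exact h m m.2.1 m.2.2

lemma sinh_div_sinh_nonneg (η x : ℝ) (hx : 0 ≤ x) :
    0 ≤ Real.sinh (η * x) / Real.sinh (2 * η) := by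
  rcases le_total 0 η with h | h
  · exact div_nonneg (Real.sinh_nonneg_iff.2 (mul_nonneg h hx))
      (Real.sinh_nonneg_iff.2 (by linarith))
  · exact div_nonneg_of_nonpos (Real.sinh_nonpos_iff.2 (mul_nonpos_of_nonpos_of_nonneg h hx))
      (Real.sinh_nonpos_iff.2 (by linarith))

lemma qnum_mul_nonneg (η : ℝ) {a b : ℤ} (ha : 0 ≤ a) (hb : 0 ≤ b) (hab : Odd (a + b)) :
    0 ≤ qnum η a * qnum η b * gam η := by
  wlog h : Even a generalizing a b
  · rw [mul_comm (qnum η a)]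
    refine this hb ha (by rwa [add_comm]) ?_
    rw [Int.not_even_iff_odd] at h
    by_contra hb'
    rw [Int.not_even_iff_odd] at hb'
    exact (Int.not_even_iff_odd.2 hab) (h.add_odd hb')
  have hb' : Odd b := by
    by_contra hb'
    rw [Int.not_odd_iff_even] at hb'
    exact (Int.not_even_iff_odd.2 hab) (h.add hb')
  have h1 := sinh_div_sinh_nonneg η ((a : ℝ) / 4) (by positivity)
  rw [qnum_even η h, qnum_odd η hb', gam,
    show Real.sinh (η * a / 4) / Real.cosh (η / 4) * (Real.cosh (η * b / 4) / Real.cosh (η / 4)) *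
      (Real.cosh (η / 4) / Real.sinh (2 * η)) =
      (Real.sinh (η * (a / 4)) / Real.sinh (2 * η)) *
        (Real.cosh (η * b / 4) / Real.cosh (η / 4) * (Real.cosh (η / 4) / Real.cosh (η / 4)))
      by rw [mul_div_assoc η]; ring]
  have := Real.cosh_pos (η * b / 4)
  have := Real.cosh_pos (η / 4)
  positivity

lemma qnum_identity (η : ℝ) {a b : ℤ} (hab : Even (a + b)) :
    (-1) ^ (b + 1) * (qnum η a * qnum η (b + 1) * gam η)
      + (-1) ^ b * (qnum η b * qnum η (a + 1) * gam η)
      = -(Real.sinh (η * (a - b) / 4) / Real.sinh (2 * η)) := by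
  have hc : Real.cosh (η / 4) ≠ 0 := (Real.cosh_pos _).ne'
  have e1 : ∀ x : ℤ, η * ((x + 1 : ℤ) : ℝ) / 4 = η * x / 4 + η / 4 := by
    intro x; push_cast; ring
  have e2 : η * ((a : ℝ) - b) / 4 = η * a / 4 - η * b / 4 := by ring
  by_cases h : Even b
  · have ha : Even a := by simpa [h] using Int.even_add.1 hab
    rw [h.neg_one_zpow, h.add_one.neg_one_zpow, qnum_even η ha, qnum_even η h,
      qnum_odd η h.add_one, qnum_odd η ha.add_one, e1, e1, e2, gam]
    rw [Real.cosh_add, Real.cosh_add, Real.sinh_sub]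
    rcases eq_or_ne (Real.sinh (2 * η)) 0 with h0 | h0
    · simp [h0]
    field_simp
    ring
  · have hb := Int.not_even_iff_odd.1 h
    have ha : Odd a := by
      rw [← Int.not_even_iff_odd]; simpa [h] using Int.even_add.1 hab
    rw [hb.neg_one_zpow, hb.add_one.neg_one_zpow, qnum_odd η ha, qnum_odd η hb,
      qnum_even η hb.add_one, qnum_even η ha.add_one, e1, e1, e2, gam]
    rw [Real.sinh_add, Real.sinh_add, Real.sinh_sub]
    rcases eq_or_ne (Real.sinh (2 * η)) 0 with h0 | h0
    · simp [h0]
    field_simp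
    ring

lemma anticomm_coeff (η : ℝ) (l : ℕ) {m : ℤ} (h1 : -(l : ℤ) ≤ m) (h2 : m ≤ l) :
    cminus η l m * cplus η l (m - 1) + cplus η l m * cminus η l (m + 1)
      = -(1 / (2 * Real.sinh (2 * η))) * (q η ^ (-(m : ℝ)) - q η ^ (m : ℝ)) := by
  have n1 := qnum_mul_nonneg η (a := l + m) (b := l - m + 1) (by omega) (by omega)
    (by rw [show (l : ℤ) + m + (l - m + 1) = 2 * l + 1 by ring]; exact odd_two_mul_add_one _)
  have n2 := qnum_mul_nonneg η (a := l - m) (b := l + m + 1) (by omega) (by omega)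
    (by rw [show (l : ℤ) - m + (l + m + 1) = 2 * l + 1 by ring]; exact odd_two_mul_add_one _)
  have id := qnum_identity η (a := l + m) (b := l - m)
    (by rw [show (l : ℤ) + m + (l - m) = 2 * l by ring]; exact even_two_mul _)
  have k1 : cminus η l m * cplus η l (m - 1) =
      (-1) ^ ((l : ℤ) - m + 1) * (qnum η (l + m) * qnum η (l - m + 1) * gam η) := by
    rw [cminus, cplus, show (l : ℤ) - (m - 1) = l - m + 1 by ring,
      show (l : ℤ) + (m - 1) + 1 = l + m by ring, mul_comm (qnum η (l - m + 1)),
      mul_left_comm, Real.mul_self_sqrt n1]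
  have k2 : cplus η l m * cminus η l (m + 1) =
      (-1) ^ ((l : ℤ) - m) * (qnum η (l - m) * qnum η (l + m + 1) * gam η) := by
    rw [cminus, cplus, show (l : ℤ) - (m + 1) + 1 = l - m by ring,
      show (l : ℤ) + (m + 1) = l + m + 1 by ring, mul_comm (qnum η (l + m + 1)),
      mul_assoc, Real.mul_self_sqrt n2]
  rw [k1, k2, id, q_rpow, q_rpow]
  push_cast
  rw [show η * ((l : ℝ) + m - (l - m)) / 4 = η * m / 2 by ring, Real.sinh_eq,
    show -η * -(m : ℝ) / 2 = η * m / 2 by ring, show -η * (m : ℝ) / 2 = -(η * m / 2) by ring]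
  ring

/-- The irreducible representation `π^l` on `V^l`. -/
def rep (η : ℝ) (l : ℕ) : U η →ₐ[ℂ] Module.End ℂ (V l) :=
  lift η (HOp l) (KOp η l) (KinvOp η l) (vpOp η l) (vmOp η l)
    (by
      refine end_ext fun m _ _ => ?_
      rw [Module.End.mul_apply, KinvOp_e, map_smul, KOp_e, smul_smul, mul_comm, qpow_mul_neg,
        one_smul, Module.End.one_apply])
    (by
      refine end_ext fun m _ _ => ?_
      rw [Module.End.mul_apply, KOp_e, map_smul, KinvOp_e, smul_smul, qpow_mul_neg,
        one_smul, Module.End.one_apply])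
    (by
      refine end_ext fun m _ _ => ?_
      rw [Module.End.mul_apply, Module.End.mul_apply, KOp_e, HOp_e, map_smul, map_smul, KOp_e,
        HOp_e, smul_comm])
    (by
      refine end_ext fun m _ _ => ?_
      rw [LinearMap.add_apply, LinearMap.smul_apply, Module.End.mul_apply, Module.End.mul_apply,
        HOp_e, vpOp_e, map_smul, map_smul, HOp_e, vpOp_e]
      simp only [smul_smul, ← add_smul]
      congr 1
      push_cast
      ring)
    (by
      refine end_ext fun m _ _ => ?_
      rw [LinearMap.sub_apply, LinearMap.smul_apply, Module.End.mul_apply, Module.End.mul_apply,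
        HOp_e, vmOp_e, map_smul, map_smul, HOp_e, vmOp_e]
      simp only [smul_smul, ← sub_smul]
      congr 1
      push_cast
      ring)
    (by
      refine end_ext fun m _ _ => ?_
      rw [LinearMap.smul_apply, Module.End.mul_apply, Module.End.mul_apply,
        KOp_e, vpOp_e, map_smul, map_smul, KOp_e, vpOp_e]
      simp only [smul_smul]
      congr 1
      rw [show ((m + 1 : ℤ) : ℝ) / 2 = 1 / 2 + (m : ℝ) / 2 by push_cast; ring, qpow_add]
      ring)
    (by
      refine end_ext fun m _ _ => ?_
      rw [LinearMap.smul_apply, Module.End.mul_apply, Module.End.mul_apply,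
        KOp_e, vmOp_e, map_smul, map_smul, KOp_e, vmOp_e]
      simp only [smul_smul]
      congr 1
      rw [show ((m - 1 : ℤ) : ℝ) / 2 = -(1 / 2) + (m : ℝ) / 2 by push_cast; ring, qpow_add]
      ring)
    (by
      refine end_ext fun m h1 h2 => ?_
      rw [LinearMap.add_apply, LinearMap.smul_apply, LinearMap.sub_apply, pow_two, pow_two]
      simp only [Module.End.mul_apply, KOp_e, KinvOp_e, vpOp_e, vmOp_e, map_smul, smul_smul,
        sub_add_cancel, add_sub_cancel_right, ← add_smul, ← sub_smul, ← qpow_add]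
      congr 1
      have := congrArg (fun x : ℝ => (x : ℂ)) (anticomm_coeff η l h1 h2)
      rw [show -((m : ℝ) / 2) + -((m : ℝ) / 2) = -(m : ℝ) by ring, add_halves, qpow, qpow]
      push_cast at this ⊢
      exact this)

/-- The degree `l - m + lam` of the basis vector `e_m` of the graded space `V^l(lam)`. -/
def deg (l : ℕ) (lam : ZMod 2) (m : ℤ) : ZMod 2 := (((l : ℤ) - m : ℤ) : ZMod 2) + lam

/-- The map `x ↦ (-1)^|x| x` of the graded space `V^l(lam)`. -/
def parOp (l : ℕ) (lam : ZMod 2) : Module.End ℂ (V l) := shift l 0 (fun m => psign (deg l lam m))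

/-! ### Tensor products and Clebsch-Gordan coefficients -/

/-- For `x = ∑ a₁ ⊗ a₂`, the operator `v ⊗ w ↦ ∑ (-1)^(|a₂| |v|) (a₁ v) ⊗ (a₂ w)` on
`V^(l₁)(lam₁) ⊗ V^(l₂)(lam₂)`. The sum is split according to the parity of `a₂`. -/
def tensorAux (η : ℝ) (l₁ : ℕ) (lam₁ : ZMod 2) (l₂ : ℕ) :
    U η ⊗[ℂ] U η →ₗ[ℂ] Module.End ℂ (V l₁ ⊗[ℂ] V l₂) :=
  TensorProduct.lift (LinearMap.mk₂ ℂ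
    (fun a₁ a₂ => TensorProduct.map (rep η l₁ a₁) (rep η l₂ (evenPart η a₂))
      + TensorProduct.map (rep η l₁ a₁ ∘ₗ parOp l₁ lam₁) (rep η l₂ (oddPart η a₂)))
    (fun a a' b => by
      simp only [map_add, TensorProduct.map_add_left, LinearMap.add_comp]; abel)
    (fun c a b => by
      simp only [map_smul, TensorProduct.map_smul_left, LinearMap.smul_comp, smul_add])
    (fun a b b' => by
      simp only [map_add, TensorProduct.map_add_right]; abel)
    (fun c a b => by
      simp only [map_smul, TensorProduct.map_smul_right, smul_add]))

/-- The action of `U_q[osp(1|2)]` on `V^(l₁)(lam₁) ⊗ V^(l₂)(lam₂)` through the comultiplication. -/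
def tensorAct (η : ℝ) (l₁ : ℕ) (lam₁ : ZMod 2) (l₂ : ℕ) (a : U η) :
    Module.End ℂ (V l₁ ⊗[ℂ] V l₂) :=
  tensorAux η l₁ lam₁ l₂ ((GradedTensorProduct.of ℂ (gr η) (gr η)).symm (comul η a))

/-- The linear map `V^l → V^(l₁) ⊗ V^(l₂)` with
`e_m ↦ e_m(l₁, l₂) = ∑ C m₁ m₂ m • (e_(m₁) ⊗ e_(m₂))`. -/
def reducedMap (l₁ l₂ l : ℕ) (C : Weight l₁ → Weight l₂ → Weight l → ℝ) :
    V l →ₗ[ℂ] V l₁ ⊗[ℂ] V l₂ :=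
  (Pi.basisFun ℂ (Weight l)).constr ℂ
    (fun m => ∑ m₁ : Weight l₁, ∑ m₂ : Weight l₂, (C m₁ m₂ m : ℂ) • (e l₁ m₁ ⊗ₜ[ℂ] e l₂ m₂))

/-- `C m₁ m₂ m = (l₁ m₁ lam₁, l₂ m₂ lam₂ | l m lam)_q`: the vectors
`e_m(l₁, l₂, lam) = ∑ C m₁ m₂ m • (e_(m₁) ⊗ e_(m₂))` form a standard basis of a copy of
`V^l(lam)` in `V^(l₁)(lam₁) ⊗ V^(l₂)(lam₂)`, pseudo-orthonormal for the form in which the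
`e_(m₁) ⊗ e_(m₂)` are orthogonal with squares `(-1)^((l₁-m₁)(l₂-m₂))`, and with the phase
fixed by positivity of the coefficient with `m₁ = l₁` and `m = l`. -/
structure IsClebschGordan (η : ℝ) (l₁ : ℕ) (lam₁ : ZMod 2) (l₂ : ℕ) (lam₂ : ZMod 2)
    (l : ℕ) (lam : ZMod 2) (C : Weight l₁ → Weight l₂ → Weight l → ℝ) : Prop where
  /-- `v_±` and `H` act on the reduced basis as on the standard basis of `V^l`. -/
  standard : ∀ a ∈ ({H η, vp η, vm η} : Set (U η)), ∀ x : V l,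
    tensorAct η l₁ lam₁ l₂ a (reducedMap l₁ l₂ l C x) = reducedMap l₁ l₂ l C (rep η l a x)
  /-- The vector `e_m(l₁, l₂, lam)` is homogeneous, of the degree of `e_m` in `V^l(lam)`. -/
  homogeneous : ∀ m₁ m₂ m, C m₁ m₂ m ≠ 0 → deg l₁ lam₁ m₁ + deg l₂ lam₂ m₂ = deg l lam m
  /-- The pseudo-orthogonality relations. -/
  orthogonal : ∀ m m' : Weight l,
    ∑ m₁ : Weight l₁, ∑ m₂ : Weight l₂,
      (-1) ^ (((l₁ : ℤ) - m₁) * ((l₂ : ℤ) - m₂)) * (C m₁ m₂ m * C m₁ m₂ m')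
      = if m = m' then (-1) ^ (((l : ℤ) - m) * ((l₁ : ℤ) + l₂ + l)) else 0
  /-- The phase convention. -/
  phase : ∀ (m₁ : Weight l₁) (m₂ : Weight l₂) (m : Weight l), (m₁ : ℤ) = l₁ → (m : ℤ) = l →
    (m₁ : ℤ) + m₂ = m → 0 < C m₁ m₂ m

open Classical in
/-- The Clebsch-Gordan coefficient `(l₁ m₁ lam₁, l₂ m₂ lam₂ | l m lam)_q`; it is set to zero
if `V^l(lam)` does not occur in `V^(l₁)(lam₁) ⊗ V^(l₂)(lam₂)`. -/
def clebschGordan (η : ℝ) (l₁ : ℕ) (lam₁ : ZMod 2) (l₂ : ℕ) (lam₂ : ZMod 2)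
    (l : ℕ) (lam : ZMod 2) : Weight l₁ → Weight l₂ → Weight l → ℝ :=
  if h : ∃ C, IsClebschGordan η l₁ lam₁ l₂ lam₂ l lam C then h.choose else 0

/-- The modified coefficient `[l₁ m₁ lam₁, l₂ m₂ lam₂ | l m lam]_q =
(-1)^((l₁-m₁)(l₂-m₂)) (-1)^((l-m)(l₁+l₂+l)) (l₁ m₁ lam₁, l₂ m₂ lam₂ | l m lam)_q`. -/
def modifiedCG (η : ℝ) (l₁ : ℕ) (m₁ : Weight l₁) (lam₁ : ZMod 2) (l₂ : ℕ) (m₂ : Weight l₂)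
    (lam₂ : ZMod 2) (l : ℕ) (m : Weight l) (lam : ZMod 2) : ℝ :=
  (-1) ^ (((l₁ : ℤ) - m₁) * ((l₂ : ℤ) - m₂)) * (-1) ^ (((l : ℤ) - m) * ((l₁ : ℤ) + l₂ + l)) *
    clebschGordan η l₁ lam₁ l₂ lam₂ l lam m₁ m₂ m

/-! ### The elements `t^l_m` and the reduced matrix element -/

/-- The basis vector
`t^l_m = ([l+m]! / ([2l]! [l-m]! γ^(l-m)))^(1/2) (ad v₋)^(l-m) (v₊^l q^(lH))` of `U^l`. -/
def t (η : ℝ) (l : ℕ) (m : Weight l) : U η :=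
  ((√(qfact η (l + m : ℤ).toNat /
      (qfact η (2 * l) * qfact η (l - m : ℤ).toNat * gam η ^ (l - m : ℤ).toNat)) : ℝ) : ℂ) •
    ((ad η (vm η)) ^ (l - m : ℤ).toNat) (vp η ^ l * K η ^ l)

/-- The reduced matrix element
`α = (-1)^(l(l+1)/2) q^(-l(l+1)/4) |[l]!| ([2j+l+1]! γ^l / ([2l]! [2j-l]! [2j+1]))^(1/2)`. -/
def alpha (η : ℝ) (l j : ℕ) : ℝ :=
  (-1) ^ (l * (l + 1) / 2) * q η ^ (-((l : ℝ) * (l + 1)) / 4) * |qfact η l| *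
    √(qfact η (2 * j + l + 1) * gam η ^ l /
      (qfact η (2 * l) * qfact η (2 * j - l) * qnum η (2 * j + 1)))

end UqOsp

end

/-!
The elements `t^l_p` are a standard basis of a copy of `V^l` for the adjoint action, so
`e_p ⊗ e_n ↦ t^l_p e_n` is an intertwiner `V^l ⊗ V^j → V^j`. Up to signs `v₊` and `v₋` are transposes
of each other in every `V^l`, hence the transpose of this intertwiner, with suitable signs, is an
intertwiner `V^j → V^l ⊗ V^j`. There is only one such intertwiner up to a factor
(`IsStandard.eq_zero`), so its coefficients are the Clebsch-Gordan coefficients up to a factor,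
which is the reduced matrix element.

The argument is carried out on coefficients. `tensorCoeff η l j p n` is the matrix element of
`t^l_p` between `e_n` and `e_(n+p)`, and `tensorCoeff_minus`, `tensorCoeff_plus` are its recursions
under `v₋` and `v₊`. The one under `v₋` holds by the definition of `t^l_p`, except that
`(ad v₋)^(2l+1) (v₊^l q^(lH))` has to vanish in `V^j` (`rep_lowered_eq_zero`). The one under `v₊`
follows from the anticommutator of `ad v₊` and `ad v₋` (`ad_anticomm_of_weight`), since
`v₊^l q^(lH)` is annihilated by `ad v₊`. `IsStandard` is the coefficient form of the intertwining
property in the definition of the Clebsch-Gordan coefficients, and it turns into these two recursions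
for the family `tensorCG` (`isStandard_tensorCG`).

The factor is found from the normalization. The signed sum of squares `normSum η l j m` does not
depend on `m`, because `v₊` and `v₋` are adjoint for the indefinite form (`normSum_sub_one`). For
`m = j` the image of `e_j` is a highest weight vector, which gives a two-term recursion for its
components. In terms of `Q = -q` the super `q`-numbers are Gaussian numbers up to powers of `q`, the
signs are absorbed, and the sum is a case of the `Q`-Vandermonde identity (`sum_gaussBinom`); the
value is the square of the reduced matrix element (`normSum_top`). The sign of the reduced matrix
element is that of the matrix element of `v₊^l q^(lH)` between `e_(j-l)` and `e_j`, as the phase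
convention requires (`tensorCoeff_top_div_alpha_pos`).
-/

noncomputable section

namespace UqOsp

/-! ### Scalars -/

lemma neg_one_zpow_add (a b : ℤ) : (-1 : ℝ) ^ (a + b) = (-1) ^ a * (-1) ^ b :=
  zpow_add₀ (by norm_num) a b

lemma neg_one_zpow_sub (a b : ℤ) : (-1 : ℝ) ^ (a - b) = (-1) ^ a * (-1) ^ b := by
  rw [zpow_sub₀ (by norm_num), div_eq_mul_inv, ← inv_zpow, inv_neg_one]

lemma neg_one_zpow_mul_self (a : ℤ) : (-1 : ℝ) ^ a * (-1) ^ a = 1 := by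
  rw [← mul_zpow]; norm_num

lemma cplus_eq (η : ℝ) (l : ℕ) (m : ℤ) :
    cplus η l m = (-1) ^ ((l : ℤ) - m) * cminus η l (m + 1) := by
  rw [cplus, cminus, show (l : ℤ) - (m + 1) + 1 = l - m by ring, ← add_assoc,
    mul_comm (qnum η (l - m))]

lemma cminus_eq (η : ℝ) (l : ℕ) (m : ℤ) :
    cminus η l m = (-1) ^ ((l : ℤ) - m + 1) * cplus η l (m - 1) := by
  rw [cplus_eq, ← mul_assoc, show (l : ℤ) - m + 1 = l - (m - 1) by ring, neg_one_zpow_mul_self,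
    one_mul, sub_add_cancel]

lemma cminus_top (η : ℝ) (l : ℕ) : cminus η l (l + 1) = 0 := by
  simp [cminus, qnum_zero]

lemma cminus_bot (η : ℝ) (l : ℕ) : cminus η l (-l) = 0 := by
  simp [cminus, qnum_zero]

lemma cplus_top (η : ℝ) (l : ℕ) : cplus η l l = 0 := by
  simp [cplus, qnum_zero]

lemma cplus_bot (η : ℝ) (l : ℕ) : cplus η l (-l - 1) = 0 := by
  rw [cplus, show (l : ℤ) + (-l - 1) + 1 = 0 by ring, qnum_zero, mul_zero, zero_mul, Real.sqrt_zero,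
    mul_zero]

lemma qnum_ne_zero {η : ℝ} (hη : η ≠ 0) {n : ℤ} (hn : n ≠ 0) : qnum η n ≠ 0 := by
  have hc := Real.cosh_pos (η / 4)
  rcases Int.even_or_odd n with h | h
  · rw [qnum_even η h]
    refine div_ne_zero ?_ hc.ne'
    rw [Ne, Real.sinh_eq_zero]
    have : (n : ℝ) ≠ 0 := by exact_mod_cast hn
    positivity
  · rw [qnum_odd η h]
    exact (div_pos (Real.cosh_pos _) hc).ne'

lemma gam_ne_zero {η : ℝ} (hη : η ≠ 0) : gam η ≠ 0 := by
  refine div_ne_zero (Real.cosh_pos _).ne' ?_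
  rw [Ne, Real.sinh_eq_zero]
  simpa using hη

lemma cminus_radicand_pos {η : ℝ} (hη : η ≠ 0) {l : ℕ} {m : ℤ} (h1 : -(l : ℤ) < m) (h2 : m ≤ l) :
    0 < qnum η (l + m) * qnum η (l - m + 1) * gam η := by
  refine lt_of_le_of_ne (qnum_mul_nonneg η (by omega) (by omega) ?_) (Ne.symm ?_)
  · rw [show (l : ℤ) + m + (l - m + 1) = 2 * l + 1 by ring]; exact odd_two_mul_add_one _
  · exact mul_ne_zero (mul_ne_zero (qnum_ne_zero hη (by omega)) (qnum_ne_zero hη (by omega)))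
      (gam_ne_zero hη)

lemma cminus_pos {η : ℝ} (hη : η ≠ 0) {l : ℕ} {m : ℤ} (h1 : -(l : ℤ) < m) (h2 : m ≤ l) :
    0 < cminus η l m :=
  Real.sqrt_pos.2 (cminus_radicand_pos hη h1 h2)

lemma cminus_sq {η : ℝ} (hη : η ≠ 0) {l : ℕ} {m : ℤ} (h1 : -(l : ℤ) < m) (h2 : m ≤ l) :
    cminus η l m ^ 2 = qnum η (l + m) * qnum η (l - m + 1) * gam η :=
  Real.sq_sqrt (cminus_radicand_pos hη h1 h2).le

lemma cplus_ne_zero {η : ℝ} (hη : η ≠ 0) {l : ℕ} {m : ℤ} (h1 : -(l : ℤ) ≤ m) (h2 : m < l) :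
    cplus η l m ≠ 0 := by
  rw [cplus_eq]
  exact mul_ne_zero (zpow_ne_zero _ (by norm_num)) (cminus_pos hη (by omega) (by omega)).ne'

/-! ### Coordinates -/

/-- The coordinate of a vector of `V^l` at the weight `p`, which is zero for `p` outside
`{-l, …, l}`. -/
def coord (l : ℕ) (p : ℤ) : V l →ₗ[ℂ] ℂ :=
  if h : p ∈ Set.Icc (-(l : ℤ)) l then LinearMap.proj ⟨p, h⟩ else 0

lemma coord_of_mem {l : ℕ} (p : Weight l) (x : V l) : coord l p x = x p := by
  rw [coord, dif_pos p.2]; rfl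

lemma coord_of_not_mem {l : ℕ} {p : ℤ} (hp : p ∉ Set.Icc (-(l : ℤ)) l) : coord l p = 0 := by
  rw [coord, dif_neg hp]

lemma coord_e {l : ℕ} {p : ℤ} (hp : p ∈ Set.Icc (-(l : ℤ)) l) (m : ℤ) :
    coord l p (e l m) = if p = m then 1 else 0 :=
  coord_of_mem ⟨p, hp⟩ _

lemma coord_e_of_ne {l : ℕ} {p m : ℤ} (h : p ≠ m) : coord l p (e l m) = 0 := by
  by_cases hp : p ∈ Set.Icc (-(l : ℤ)) l
  · rw [coord_e hp, if_neg h]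
  · rw [coord_of_not_mem hp, LinearMap.zero_apply]

lemma coord_shift {l : ℕ} {s : ℤ} {c : ℤ → ℂ}
    (h : ∀ m : ℤ, m ∈ Set.Icc (-(l : ℤ)) l → m + s ∉ Set.Icc (-(l : ℤ)) l → c m = 0)
    (p : ℤ) (x : V l) : coord l p (shift l s c x) = c (p - s) * coord l (p - s) x := by
  suffices coord l p ∘ₗ shift l s c = c (p - s) • coord l (p - s) from
    DFunLike.congr_fun this x
  refine (Pi.basisFun ℂ (Weight l)).ext fun m => ?_
  rw [LinearMap.comp_apply, LinearMap.smul_apply, shift, Module.Basis.constr_basis, ← e_coe,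
    map_smul, smul_eq_mul, smul_eq_mul]
  by_cases hpm : p = m + s
  · subst hpm
    rw [add_sub_cancel_right, coord_e m.2, if_pos rfl]
    by_cases hm : (m : ℤ) + s ∈ Set.Icc (-(l : ℤ)) l
    · rw [coord_e hm, if_pos rfl]
    · rw [h m m.2 hm, zero_mul, zero_mul]
  · rw [coord_e_of_ne hpm, coord_e_of_ne (by omega), mul_zero, mul_zero]

@[simp] lemma rep_H (l : ℕ) (η : ℝ) : rep η l (H η) = HOp l := lift_H

@[simp] lemma rep_K (l : ℕ) (η : ℝ) : rep η l (K η) = KOp η l := lift_K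

@[simp] lemma rep_Kinv (l : ℕ) (η : ℝ) : rep η l (Kinv η) = KinvOp η l := lift_Kinv

@[simp] lemma rep_vp (l : ℕ) (η : ℝ) : rep η l (vp η) = vpOp η l := lift_vp

@[simp] lemma rep_vm (l : ℕ) (η : ℝ) : rep η l (vm η) = vmOp η l := lift_vm

lemma coord_vpOp (η : ℝ) (l : ℕ) (p : ℤ) (x : V l) :
    coord l p (vpOp η l x) = cplus η l (p - 1) * coord l (p - 1) x := by
  refine coord_shift (c := fun m => (cplus η l m : ℂ)) (fun m h1 h2 => ?_) p x
  have : m = l := by simp only [Set.mem_Icc] at h1 h2; omega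
  simp [this, cplus_top]

lemma coord_vmOp (η : ℝ) (l : ℕ) (p : ℤ) (x : V l) :
    coord l p (vmOp η l x) = cminus η l (p + 1) * coord l (p + 1) x := by
  have := coord_shift (s := -1) (c := fun m => (cminus η l m : ℂ)) (l := l) (fun m h1 h2 => ?_) p x
  · rwa [sub_neg_eq_add] at this
  · have : m = -l := by simp only [Set.mem_Icc] at h1 h2; omega
    simp [this, cminus_bot]

lemma coord_diag (l : ℕ) (c : ℤ → ℂ) (p : ℤ) (x : V l) :
    coord l p (shift l 0 c x) = c p * coord l p x := by
  have := coord_shift (s := 0) (c := c) (l := l)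
    (fun m h1 h2 => absurd h1 (by simpa using h2)) p x
  rwa [sub_zero] at this

lemma coord_HOp (l : ℕ) (p : ℤ) (x : V l) : coord l p (HOp l x) = p / 2 * coord l p x :=
  coord_diag _ _ _ _

lemma coord_KOp (η : ℝ) (l : ℕ) (p : ℤ) (x : V l) :
    coord l p (KOp η l x) = (q η ^ ((p : ℝ) / 2) : ℝ) * coord l p x :=
  coord_diag _ _ _ _

lemma coord_KinvOp (η : ℝ) (l : ℕ) (p : ℤ) (x : V l) :
    coord l p (KinvOp η l x) = (q η ^ (-((p : ℝ) / 2)) : ℝ) * coord l p x :=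
  coord_diag _ _ _ _

/-- The real sign `(-1)^|e_m|` of the basis vector `e_m` of `V^l(lam)`. -/
def esign (l : ℕ) (lam : ZMod 2) (m : ℤ) : ℝ := if deg l lam m = 0 then 1 else -1

lemma coord_parOp (l : ℕ) (lam : ZMod 2) (p : ℤ) (x : V l) :
    coord l p (parOp l lam x) = (esign l lam p : ℝ) * coord l p x := by
  rw [parOp, coord_diag, psign, esign]
  split_ifs <;> simp

/-- The coordinate of a tensor at `e_p ⊗ e_n`, zero for `p` or `n` out of range. -/
def coord₂ (l₁ l₂ : ℕ) (p n : ℤ) : V l₁ ⊗[ℂ] V l₂ →ₗ[ℂ] ℂ :=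
  LinearMap.mul' ℂ ℂ ∘ₗ TensorProduct.map (coord l₁ p) (coord l₂ n)

lemma coord₂_tmul (l₁ l₂ : ℕ) (p n : ℤ) (x : V l₁) (y : V l₂) :
    coord₂ l₁ l₂ p n (x ⊗ₜ y) = coord l₁ p x * coord l₂ n y := rfl

lemma coord₂_ext {l₁ l₂ : ℕ} {z z' : V l₁ ⊗[ℂ] V l₂}
    (h : ∀ p n : ℤ, coord₂ l₁ l₂ p n z = coord₂ l₁ l₂ p n z') : z = z' := by
  let b := (Pi.basisFun ℂ (Weight l₁)).tensorProduct (Pi.basisFun ℂ (Weight l₂))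
  have key : ∀ (i : Weight l₁ × Weight l₂) (z : V l₁ ⊗[ℂ] V l₂),
      b.repr z i = coord₂ l₁ l₂ i.1 i.2 z := by
    rintro ⟨i, k⟩ z
    induction z with
    | zero => simp
    | add x y hx hy => rw [map_add, map_add, Finsupp.add_apply, hx, hy]
    | tmul x y =>
      rw [coord₂_tmul, coord_of_mem, coord_of_mem]
      simp [b, mul_comm]
  refine b.ext_elem fun i => ?_
  rw [key, key, h]

lemma tensorAct_H (η : ℝ) (l₁ : ℕ) (lam₁ : ZMod 2) (l₂ : ℕ) :
    tensorAct η l₁ lam₁ l₂ (H η) =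
      TensorProduct.map (HOp l₁) LinearMap.id + TensorProduct.map LinearMap.id (HOp l₂) := by
  have h1 : (1 : U η) ∈ gr η 0 := SetLike.GradedOne.one_mem
  simp [tensorAct, tensorAux, evenPart_of_mem_zero h1, oddPart_of_mem_zero h1,
    evenPart_of_mem_zero H_mem, oddPart_of_mem_zero H_mem]
  rfl

lemma tensorAct_vp (η : ℝ) (l₁ : ℕ) (lam₁ : ZMod 2) (l₂ : ℕ) :
    tensorAct η l₁ lam₁ l₂ (vp η) = TensorProduct.map (vpOp η l₁) (KOp η l₂)
      + TensorProduct.map (KinvOp η l₁ ∘ₗ parOp l₁ lam₁) (vpOp η l₂) := by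
  simp [tensorAct, tensorAux, evenPart_of_mem_zero K_mem, oddPart_of_mem_zero K_mem,
    evenPart_of_mem_one vp_mem, oddPart_of_mem_one vp_mem]

lemma tensorAct_vm (η : ℝ) (l₁ : ℕ) (lam₁ : ZMod 2) (l₂ : ℕ) :
    tensorAct η l₁ lam₁ l₂ (vm η) = TensorProduct.map (vmOp η l₁) (KOp η l₂)
      + TensorProduct.map (KinvOp η l₁ ∘ₗ parOp l₁ lam₁) (vmOp η l₂) := by
  simp [tensorAct, tensorAux, evenPart_of_mem_zero K_mem, oddPart_of_mem_zero K_mem,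
    evenPart_of_mem_one vm_mem, oddPart_of_mem_one vm_mem]

lemma coord₂_H (η : ℝ) (l₁ : ℕ) (lam₁ : ZMod 2) (l₂ : ℕ) (p n : ℤ) (z : V l₁ ⊗[ℂ] V l₂) :
    coord₂ l₁ l₂ p n (tensorAct η l₁ lam₁ l₂ (H η) z) =
      ((p : ℂ) / 2 + n / 2) * coord₂ l₁ l₂ p n z := by
  rw [tensorAct_H]
  induction z with
  | zero => simp
  | add x y hx hy => rw [map_add, map_add, hx, hy, map_add]; ring
  | tmul x y =>
    simp only [LinearMap.add_apply, TensorProduct.map_tmul, map_add, coord₂_tmul, coord_HOp,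
      LinearMap.id_apply]
    ring

lemma coord₂_vp (η : ℝ) (l₁ : ℕ) (lam₁ : ZMod 2) (l₂ : ℕ) (p n : ℤ) (z : V l₁ ⊗[ℂ] V l₂) :
    coord₂ l₁ l₂ p n (tensorAct η l₁ lam₁ l₂ (vp η) z) =
      (cplus η l₁ (p - 1) * q η ^ ((n : ℝ) / 2) : ℝ) * coord₂ l₁ l₂ (p - 1) n z
      + (esign l₁ lam₁ p * q η ^ (-((p : ℝ) / 2)) * cplus η l₂ (n - 1) : ℝ)
        * coord₂ l₁ l₂ p (n - 1) z := by
  rw [tensorAct_vp]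
  induction z with
  | zero => simp
  | add x y hx hy => rw [map_add, map_add, hx, hy, map_add, map_add]; ring
  | tmul x y =>
    simp only [LinearMap.add_apply, TensorProduct.map_tmul, map_add, coord₂_tmul, coord_vpOp,
      coord_KOp, coord_KinvOp, coord_parOp, LinearMap.comp_apply]
    push_cast
    ring

lemma coord₂_vm (η : ℝ) (l₁ : ℕ) (lam₁ : ZMod 2) (l₂ : ℕ) (p n : ℤ) (z : V l₁ ⊗[ℂ] V l₂) :
    coord₂ l₁ l₂ p n (tensorAct η l₁ lam₁ l₂ (vm η) z) =
      (cminus η l₁ (p + 1) * q η ^ ((n : ℝ) / 2) : ℝ) * coord₂ l₁ l₂ (p + 1) n z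
      + (esign l₁ lam₁ p * q η ^ (-((p : ℝ) / 2)) * cminus η l₂ (n + 1) : ℝ)
        * coord₂ l₁ l₂ p (n + 1) z := by
  rw [tensorAct_vm]
  induction z with
  | zero => simp
  | add x y hx hy => rw [map_add, map_add, hx, hy, map_add, map_add]; ring
  | tmul x y =>
    simp only [LinearMap.add_apply, TensorProduct.map_tmul, map_add, coord₂_tmul, coord_vmOp,
      coord_KOp, coord_KinvOp, coord_parOp, LinearMap.comp_apply]
    push_cast
    ring

/-! ### Clebsch-Gordan coefficients in coordinates -/

/-- A family of coefficients indexed by weights, extended by zero to all integers. -/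
def extendZero {l₁ l₂ l : ℕ} (C : Weight l₁ → Weight l₂ → Weight l → ℝ) (p n m : ℤ) : ℝ :=
  if h : p ∈ Set.Icc (-(l₁ : ℤ)) l₁ ∧ n ∈ Set.Icc (-(l₂ : ℤ)) l₂ ∧ m ∈ Set.Icc (-(l : ℤ)) l then
    C ⟨p, h.1⟩ ⟨n, h.2.1⟩ ⟨m, h.2.2⟩ else 0

section

variable {l₁ l₂ l : ℕ} (C : Weight l₁ → Weight l₂ → Weight l → ℝ)

lemma extendZero_coe (p : Weight l₁) (n : Weight l₂) (m : Weight l) :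
    extendZero C p n m = C p n m := by
  rw [extendZero, dif_pos ⟨p.2, n.2, m.2⟩]

lemma extendZero_of_not_mem {p n m : ℤ} (h : ¬ (p ∈ Set.Icc (-(l₁ : ℤ)) l₁ ∧
    n ∈ Set.Icc (-(l₂ : ℤ)) l₂ ∧ m ∈ Set.Icc (-(l : ℤ)) l)) : extendZero C p n m = 0 := by
  rw [extendZero, dif_neg h]

lemma coord₂_reducedMap (p n m : ℤ) :
    coord₂ l₁ l₂ p n (reducedMap l₁ l₂ l C (e l m)) = (extendZero C p n m : ℂ) := by
  by_cases hm : m ∈ Set.Icc (-(l : ℤ)) l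
  swap
  · rw [e_of_not_mem (by simpa using hm), extendZero_of_not_mem C fun h => hm h.2.2]
    simp
  lift m to Weight l using hm
  rw [e_coe, reducedMap, Module.Basis.constr_basis]
  simp only [map_sum, map_smul, coord₂_tmul, smul_eq_mul]
  by_cases hp : p ∈ Set.Icc (-(l₁ : ℤ)) l₁
  swap
  · rw [extendZero_of_not_mem C fun h => hp h.1]
    simp [coord_of_not_mem hp]
  by_cases hn : n ∈ Set.Icc (-(l₂ : ℤ)) l₂
  swap
  · rw [extendZero_of_not_mem C fun h => hn h.2.1]
    simp [coord_of_not_mem hn]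
  lift p to Weight l₁ using hp
  lift n to Weight l₂ using hn
  rw [extendZero_coe, Finset.sum_eq_single p, Finset.sum_eq_single n]
  · simp [coord_e p.2, coord_e n.2]
  · intro b _ hb
    rw [coord_e_of_ne (fun h => hb (Subtype.ext h.symm)), mul_zero, mul_zero]
  · simp
  · intro b _ hb
    refine Finset.sum_eq_zero fun k _ => ?_
    rw [coord_e_of_ne (fun h => hb (Subtype.ext h.symm)), zero_mul, mul_zero]
  · simp

end

/-- The coordinate form of the statement that the vectors `∑ A p n m • (e_p ⊗ e_n)` of
`V^(l₁)(lam₁) ⊗ V^(l₂)` are zero or form a standard basis of a copy of `V^l`. -/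
structure IsStandard (η : ℝ) (l₁ : ℕ) (lam₁ : ZMod 2) (l₂ l : ℕ) (A : ℤ → ℤ → ℤ → ℝ) : Prop where
  supp : ∀ p n m, ¬ (p ∈ Set.Icc (-(l₁ : ℤ)) l₁ ∧ n ∈ Set.Icc (-(l₂ : ℤ)) l₂ ∧
    m ∈ Set.Icc (-(l : ℤ)) l) → A p n m = 0
  weight : ∀ p n m, p + n ≠ m → A p n m = 0
  plus : ∀ p n m : ℤ, cplus η l₁ (p - 1) * q η ^ ((n : ℝ) / 2) * A (p - 1) n m
    + esign l₁ lam₁ p * q η ^ (-((p : ℝ) / 2)) * cplus η l₂ (n - 1) * A p (n - 1) m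
    = cplus η l m * A p n (m + 1)
  minus : ∀ p n m : ℤ, cminus η l₁ (p + 1) * q η ^ ((n : ℝ) / 2) * A (p + 1) n m
    + esign l₁ lam₁ p * q η ^ (-((p : ℝ) / 2)) * cminus η l₂ (n + 1) * A p (n + 1) m
    = cminus η l m * A p n (m - 1)

lemma isStandard_extendZero_iff {η : ℝ} {l₁ : ℕ} {lam₁ : ZMod 2} {l₂ l : ℕ}
    {C : Weight l₁ → Weight l₂ → Weight l → ℝ} :
    IsStandard η l₁ lam₁ l₂ l (extendZero C) ↔
      ∀ a ∈ ({H η, vp η, vm η} : Set (U η)), ∀ x : V l,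
        tensorAct η l₁ lam₁ l₂ a (reducedMap l₁ l₂ l C x) =
          reducedMap l₁ l₂ l C (rep η l a x) := by
  constructor
  · intro h a ha x
    suffices tensorAct η l₁ lam₁ l₂ a ∘ₗ reducedMap l₁ l₂ l C =
        reducedMap l₁ l₂ l C ∘ₗ rep η l a from DFunLike.congr_fun this x
    refine (Pi.basisFun ℂ (Weight l)).ext fun m => ?_
    rw [← e_coe, LinearMap.comp_apply, LinearMap.comp_apply]
    refine coord₂_ext fun p n => ?_
    rcases ha with rfl | rfl | rfl
    · rw [coord₂_H, rep_H, HOp_e, map_smul, map_smul, coord₂_reducedMap, smul_eq_mul]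
      by_cases hm : p + n = m
      · rw [← hm]; push_cast; ring
      · rw [h.weight _ _ _ hm]; simp
    · rw [coord₂_vp, rep_vp, vpOp_e, map_smul, map_smul, coord₂_reducedMap, coord₂_reducedMap,
        coord₂_reducedMap, smul_eq_mul]
      exact_mod_cast h.plus p n m
    · rw [coord₂_vm, rep_vm, vmOp_e, map_smul, map_smul, coord₂_reducedMap, coord₂_reducedMap,
        coord₂_reducedMap, smul_eq_mul]
      exact_mod_cast h.minus p n m
  · intro h
    refine ⟨fun p n m => extendZero_of_not_mem C, fun p n m hm => ?_, fun p n m => ?_,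
      fun p n m => ?_⟩
    · have := congrArg (coord₂ l₁ l₂ p n) (h (H η) (by simp) (e l m))
      rw [coord₂_H, rep_H, HOp_e, map_smul, map_smul, coord₂_reducedMap, smul_eq_mul,
        ← sub_eq_zero, ← sub_mul, mul_eq_zero] at this
      rcases this with h0 | h0
      · refine absurd ?_ hm
        have h1 : ((p + n : ℤ) : ℂ) = (m : ℤ) := by push_cast; linear_combination 2 * h0
        exact_mod_cast h1
      · exact_mod_cast h0
    · have := congrArg (coord₂ l₁ l₂ p n) (h (vp η) (by simp) (e l m))
      rw [coord₂_vp, rep_vp, vpOp_e, map_smul, map_smul, coord₂_reducedMap, coord₂_reducedMap,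
        coord₂_reducedMap, smul_eq_mul] at this
      exact_mod_cast this
    · have := congrArg (coord₂ l₁ l₂ p n) (h (vm η) (by simp) (e l m))
      rw [coord₂_vm, rep_vm, vmOp_e, map_smul, map_smul, coord₂_reducedMap, coord₂_reducedMap,
        coord₂_reducedMap, smul_eq_mul] at this
      exact_mod_cast this

/-! ### Uniqueness of the Clebsch-Gordan coefficients -/

section

variable {η : ℝ} {l₁ : ℕ} {lam₁ : ZMod 2} {l₂ l : ℕ} {A B : ℤ → ℤ → ℤ → ℝ}

lemma IsStandard.linear_comb (hA : IsStandard η l₁ lam₁ l₂ l A)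
    (hB : IsStandard η l₁ lam₁ l₂ l B) (a b : ℝ) :
    IsStandard η l₁ lam₁ l₂ l (fun p n m => a * A p n m + b * B p n m) where
  supp p n m h := by simp only [hA.supp p n m h, hB.supp p n m h]; ring
  weight p n m h := by simp only [hA.weight p n m h, hB.weight p n m h]; ring
  plus p n m := by linear_combination a * hA.plus p n m + b * hB.plus p n m
  minus p n m := by linear_combination a * hA.minus p n m + b * hB.minus p n m

/-- Since `v₊` kills the vector of weight `l`, all its coordinates are determined by the one
with first weight `l₁`; the action of `v₋` then determines the vectors of lower weight. -/
lemma IsStandard.eq_zero (hη : η ≠ 0) (hA : IsStandard η l₁ lam₁ l₂ l A)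
    (h0 : A l₁ (l - l₁) l = 0) (p n m : ℤ) : A p n m = 0 := by
  have top : ∀ k : ℕ, ∀ n : ℤ, A (l₁ - k) n l = 0 := by
    intro k
    induction k with
    | zero =>
      intro n
      by_cases hn : (l₁ : ℤ) + n = l
      · rw [← h0]
        rw [show (l₁ : ℤ) - (0 : ℕ) = l₁ by simp, show n = (l : ℤ) - l₁ by omega]
      · exact hA.weight _ _ _ (by push_cast; omega)
    | succ k ih =>
      intro n
      by_cases hk : (l₁ : ℤ) - (k + 1 : ℕ) ∈ Set.Icc (-(l₁ : ℤ)) l₁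
      swap
      · exact hA.supp _ _ _ fun h => hk h.1
      have := hA.plus (l₁ - k) n l
      rw [ih, cplus_top, mul_zero, zero_mul, add_zero,
        show (l₁ : ℤ) - k - 1 = l₁ - (k + 1 : ℕ) by push_cast; ring] at this
      simp only [Set.mem_Icc] at hk
      have hc := cplus_ne_zero hη hk.1 (by push_cast; omega)
      have hq := (Real.rpow_pos_of_pos (q_pos η) ((n : ℝ) / 2)).ne'
      exact (mul_eq_zero.1 this).resolve_left (mul_ne_zero hc hq)
  have top' : ∀ p n : ℤ, A p n l = 0 := by
    intro p n
    by_cases hp : p ∈ Set.Icc (-(l₁ : ℤ)) l₁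
    · have := top (l₁ - p).toNat n
      simp only [Set.mem_Icc] at hp
      rwa [show (l₁ : ℤ) - ((l₁ - p).toNat : ℕ) = p by omega] at this
    · exact hA.supp _ _ _ fun h => hp h.1
  have all : ∀ k : ℕ, ∀ p n : ℤ, A p n (l - k) = 0 := by
    intro k
    induction k with
    | zero => simpa using top'
    | succ k ih =>
      intro p n
      by_cases hk : (l : ℤ) - (k + 1 : ℕ) ∈ Set.Icc (-(l : ℤ)) l
      swap
      · exact hA.supp _ _ _ fun h => hk h.2.2
      have := hA.minus p n (l - k)
      rw [ih, ih, mul_zero, mul_zero, add_zero,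
        show (l : ℤ) - k - 1 = l - (k + 1 : ℕ) by push_cast; ring] at this
      simp only [Set.mem_Icc] at hk
      have hc := (cminus_pos (l := l) hη (m := l - k) (by push_cast at hk; omega) (by omega)).ne'
      simpa [hc] using this
  by_cases hm : m ∈ Set.Icc (-(l : ℤ)) l
  · have := all (l - m).toNat p n
    simp only [Set.mem_Icc] at hm
    rwa [show (l : ℤ) - ((l - m).toNat : ℕ) = m by omega] at this
  · exact hA.supp _ _ _ fun h => hm h.2.2

end

/-- There is at most one family of Clebsch-Gordan coefficients: two such families are
proportional, and the normalization and the phase convention leave no choice of the factor. -/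
lemma IsClebschGordan.unique {η : ℝ} (hη : η ≠ 0) {l₁ : ℕ} {lam₁ : ZMod 2} {l₂ : ℕ}
    {lam₂ : ZMod 2} {l : ℕ} {lam : ZMod 2} {C D : Weight l₁ → Weight l₂ → Weight l → ℝ}
    (hC : IsClebschGordan η l₁ lam₁ l₂ lam₂ l lam C)
    (hD : IsClebschGordan η l₁ lam₁ l₂ lam₂ l lam D) : C = D := by
  have hA := isStandard_extendZero_iff.2 hC.standard
  have hB := isStandard_extendZero_iff.2 hD.standard
  let ml : Weight l := ⟨l, by simp⟩
  have orth := hC.orthogonal ml ml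
  have orth' := hD.orthogonal ml ml
  rw [if_pos rfl] at orth orth'
  have hne : ((-1 : ℝ) ^ (((l : ℤ) - ml) * ((l₁ : ℤ) + l₂ + l))) ≠ 0 :=
    zpow_ne_zero _ (by norm_num)
  -- The components with first weight `l₁` of the two highest weight vectors.
  set a := extendZero C l₁ (l - l₁) l with ha
  set b := extendZero D l₁ (l - l₁) l with hb
  have prop : ∀ p n m, b * C p n m = a * D p n m := by
    intro p n m
    have := (hA.linear_comb hB b (-a)).eq_zero hη (by simp only [← ha, ← hb]; ring) p n m
    simp only [extendZero_coe] at this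
    linear_combination this
  have hsq : b ^ 2 = a ^ 2 := by
    have h1 : b ^ 2 * ∑ p : Weight l₁, ∑ n : Weight l₂,
        (-1) ^ (((l₁ : ℤ) - p) * ((l₂ : ℤ) - n)) * (C p n ml * C p n ml) =
        a ^ 2 * ∑ p : Weight l₁, ∑ n : Weight l₂,
        (-1) ^ (((l₁ : ℤ) - p) * ((l₂ : ℤ) - n)) * (D p n ml * D p n ml) := by
      simp only [Finset.mul_sum]
      refine Finset.sum_congr rfl fun p _ => Finset.sum_congr rfl fun n _ => ?_
      linear_combination (-1) ^ (((l₁ : ℤ) - p) * ((l₂ : ℤ) - n)) *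
        (b * C p n ml + a * D p n ml) * prop p n ml
    rw [orth, orth'] at h1
    exact mul_right_cancel₀ hne h1
  have pos : 0 < a ∧ 0 < b := by
    by_cases h : (l₁ : ℤ) ∈ Set.Icc (-(l₁ : ℤ)) l₁ ∧ (l : ℤ) - l₁ ∈ Set.Icc (-(l₂ : ℤ)) l₂ ∧
        (l : ℤ) ∈ Set.Icc (-(l : ℤ)) l
    · rw [ha, hb, extendZero, extendZero, dif_pos h, dif_pos h]
      exact ⟨hC.phase _ _ _ rfl rfl (by simp), hD.phase _ _ _ rfl rfl (by simp)⟩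
    -- Out of range the highest weight vector would vanish, against the normalization.
    · refine absurd orth.symm ?_
      have h0 := hA.eq_zero hη (extendZero_of_not_mem C h)
      have : ∀ p n m, C p n m = 0 := fun p n m => by rw [← extendZero_coe C, h0]
      simpa [this] using hne
  have hab : b = a := by
    rcases sq_eq_sq_iff_eq_or_eq_neg.1 hsq with h | h
    · exact h
    · linarith [pos.1, pos.2]
  funext p n m
  have := prop p n m
  rw [hab] at this
  exact mul_left_cancel₀ pos.1.ne' this

lemma IsClebschGordan.clebschGordan_eq {η : ℝ} (hη : η ≠ 0) {l₁ : ℕ} {lam₁ : ZMod 2} {l₂ : ℕ}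
    {lam₂ : ZMod 2} {l : ℕ} {lam : ZMod 2} {C : Weight l₁ → Weight l₂ → Weight l → ℝ}
    (hC : IsClebschGordan η l₁ lam₁ l₂ lam₂ l lam C) :
    clebschGordan η l₁ lam₁ l₂ lam₂ l lam = C := by
  have h : ∃ C, IsClebschGordan η l₁ lam₁ l₂ lam₂ l lam C := ⟨C, hC⟩
  rw [clebschGordan, dif_pos h]
  exact h.choose_spec.unique hη hC

/-! ### The adjoint action on the highest component -/

section

variable {η : ℝ}

lemma ad_vp (b : U η) : ad η (vp η) b =
    vp η * b * Kinv η - qpow η (1 / 2) • (Kinv η * par η b * vp η) := by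
  simp [ad, adTensor, evenPart_of_mem_zero K_mem, oddPart_of_mem_zero K_mem,
    evenPart_of_mem_one vp_mem, oddPart_of_mem_one vp_mem, mul_assoc, sub_eq_add_neg]

lemma ad_anticomm (b : U η) :
    ad η (vp η) (ad η (vm η) b) + ad η (vm η) (ad η (vp η) b) =
      -(1 / (2 * Real.sinh (2 * η) : ℂ)) •
        (Kinv η ^ 2 * b * K η ^ 2 - K η ^ 2 * b * Kinv η ^ 2) := by
  have hneg : qpow η (-(1 / 2)) = (qpow η (1 / 2))⁻¹ :=
    eq_inv_of_mul_eq_one_right (qpow_mul_neg _ _)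
  have hq : qpow η (1 / 2) ≠ 0 := left_ne_zero_of_mul_eq_one (qpow_mul_neg _ _)
  have key : ∀ x y : U η, x * (vp η * vm η) * y = -(x * (vm η * vp η) * y) +
      -(1 / (2 * Real.sinh (2 * η) : ℂ)) • (x * (Kinv η ^ 2 - K η ^ 2) * y) := by
    intro x y
    rw [← smul_mul_assoc, ← mul_smul_comm, ← vp_vm]
    noncomm_ring
  have k1 := key 1 (b * (Kinv η * Kinv η))
  have k2 := key (Kinv η * Kinv η * b) 1
  have kv : ∀ x : U η, Kinv η * (vp η * x) = qpow η (-(1 / 2)) • (vp η * (Kinv η * x)) := by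
    intro x; rw [← mul_assoc, Kinv_vp, smul_mul_assoc, mul_assoc]
  have kw : ∀ x : U η, Kinv η * (vm η * x) = qpow η (1 / 2) • (vm η * (Kinv η * x)) := by
    intro x; rw [← mul_assoc, Kinv_vm, smul_mul_assoc, mul_assoc]
  simp only [one_mul, mul_one, pow_two, mul_sub, sub_mul, mul_assoc] at k1 k2
  rw [ad_vm, ad_vp, ad_vp, ad_vm]
  simp only [map_sub, map_smul, map_mul, par_vm, par_vp, par_Kinv, par_par, mul_sub, sub_mul,
    mul_smul_comm, smul_mul_assoc, mul_neg, neg_mul, smul_neg, kv, kw, Kinv_vp, Kinv_vm,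
    smul_sub, smul_smul, mul_assoc, k1, k2, pow_two]
  generalize -(1 / (2 * Real.sinh (2 * η) : ℂ)) = c
  rw [hneg]
  match_scalars <;> field_simp <;> ring

/-- On an element of weight `w`, the anticommutator of the adjoint actions of `v₊` and `v₋` is
the scalar by which `v₊ v₋ + v₋ v₊` acts on a weight vector. -/
lemma ad_anticomm_of_weight {w : ℤ} {b : U η} (hb : K η * b = qpow η ((w : ℝ) / 2) • (b * K η)) :
    ad η (vp η) (ad η (vm η) b) + ad η (vm η) (ad η (vp η) b) =
      ((-(1 / (2 * Real.sinh (2 * η))) * (q η ^ (-(w : ℝ)) - q η ^ (w : ℝ)) : ℝ) : ℂ) • b := by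
  have hb' : b * K η = qpow η (-((w : ℝ) / 2)) • (K η * b) := by
    rw [hb, smul_smul, mul_comm, qpow_mul_neg, one_smul]
  have h1 : K η ^ 2 * b * Kinv η ^ 2 = qpow η w • b := by
    rw [pow_two, pow_two, show K η * K η * b * (Kinv η * Kinv η) =
      K η * (K η * b) * Kinv η * Kinv η by noncomm_ring, hb]
    rw [show K η * (qpow η ((w : ℝ) / 2) • (b * K η)) * Kinv η * Kinv η =
      qpow η ((w : ℝ) / 2) • ((K η * b) * (K η * Kinv η) * Kinv η) by
        simp only [mul_smul_comm, smul_mul_assoc, mul_assoc], K_Kinv, mul_one, hb, smul_mul_assoc,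
      mul_assoc, K_Kinv, mul_one, smul_smul, ← qpow_add, add_halves]
  have h2 : Kinv η ^ 2 * b * K η ^ 2 = qpow η (-w) • b := by
    rw [pow_two, pow_two, show Kinv η * Kinv η * b * (K η * K η) =
      Kinv η * Kinv η * (b * K η) * K η by noncomm_ring, hb']
    rw [show Kinv η * Kinv η * (qpow η (-((w : ℝ) / 2)) • (K η * b)) * K η =
      qpow η (-((w : ℝ) / 2)) • (Kinv η * (Kinv η * K η) * (b * K η)) by
        simp only [mul_smul_comm, smul_mul_assoc, mul_assoc], Kinv_K, mul_one, hb',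
      mul_smul_comm, ← mul_assoc, Kinv_K, one_mul, smul_smul, ← qpow_add, ← neg_add, add_halves]
  rw [ad_anticomm, h1, h2, ← sub_smul, smul_smul, qpow, qpow]
  push_cast
  rfl

/-- The elements `(ad v₋)^k (v₊^l q^(lH))`, of which the `t^l_(l-k)` are multiples. -/
def lowered (η : ℝ) (l k : ℕ) : U η := ((ad η (vm η)) ^ k) (vp η ^ l * K η ^ l)

lemma lowered_zero (l : ℕ) : lowered η l 0 = vp η ^ l * K η ^ l := rfl

lemma lowered_succ (l k : ℕ) : lowered η l (k + 1) = ad η (vm η) (lowered η l k) := by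
  rw [lowered, pow_succ', Module.End.mul_apply, lowered]

lemma par_lowered {l : ℕ} (hl : Even l) (k : ℕ) :
    par η (lowered η l k) = (-1 : ℂ) ^ k • lowered η l k := by
  induction k with
  | zero => rw [lowered_zero, map_mul, map_pow, map_pow, par_vp, par_K, hl.neg_pow, pow_zero,
      one_smul]
  | succ k ih =>
    rw [lowered_succ, ad_vm, map_sub, map_smul]
    simp only [map_mul, ih, par_vm, par_Kinv, map_smul, smul_sub, smul_smul, mul_smul_comm,
      smul_mul_assoc, mul_neg, neg_mul, smul_neg]
    match_scalars <;> ring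

lemma K_vp_pow (k : ℕ) : K η * vp η ^ k = qpow η ((k : ℝ) / 2) • (vp η ^ k * K η) := by
  induction k with
  | zero => simp [qpow_zero]
  | succ k ih =>
    rw [pow_succ, ← mul_assoc, ih, smul_mul_assoc, mul_assoc, K_vp, mul_smul_comm, smul_smul,
      ← qpow_add, mul_assoc]
    congr 2
    push_cast
    ring

lemma Kinv_vp_pow (k : ℕ) : Kinv η * vp η ^ k = qpow η (-((k : ℝ) / 2)) • (vp η ^ k * Kinv η) := by
  induction k with
  | zero => simp [qpow_zero]
  | succ k ih =>
    rw [pow_succ, ← mul_assoc, ih, smul_mul_assoc, mul_assoc, Kinv_vp, mul_smul_comm, smul_smul,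
      ← qpow_add, mul_assoc]
    congr 2
    push_cast
    ring

lemma K_pow_vp (k : ℕ) : K η ^ k * vp η = qpow η ((k : ℝ) / 2) • (vp η * K η ^ k) := by
  induction k with
  | zero => simp [qpow_zero]
  | succ k ih =>
    rw [pow_succ', mul_assoc, ih, mul_smul_comm, ← mul_assoc, K_vp, smul_mul_assoc, smul_smul,
      ← qpow_add, mul_assoc]
    congr 2
    push_cast
    ring

lemma K_lowered (l k : ℕ) : K η * lowered η l k =
    qpow η (((l - k : ℤ) : ℝ) / 2) • (lowered η l k * K η) := by
  induction k with
  | zero =>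
    rw [lowered_zero, ← mul_assoc, K_vp_pow, smul_mul_assoc, mul_assoc, mul_assoc, ← pow_succ,
      ← pow_succ']
    simp
  | succ k ih =>
    have e : qpow η (((l - (k + 1 : ℕ) : ℤ) : ℝ) / 2) =
        qpow η (-(1 / 2)) * qpow η (((l - k : ℤ) : ℝ) / 2) := by
      rw [← qpow_add]; congr 1; push_cast; ring
    have ih' := congrArg (par η) ih
    simp only [map_mul, map_smul, par_K] at ih'
    have hK : Kinv η * K η = K η * Kinv η := by rw [K_Kinv, Kinv_K]
    rw [lowered_succ, ad_vm, e, mul_sub, sub_mul, smul_sub]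
    congr 1
    · calc K η * (vm η * lowered η l k * Kinv η) = (K η * vm η) * lowered η l k * Kinv η := by
            noncomm_ring
        _ = qpow η (-(1 / 2)) • (vm η * (K η * lowered η l k) * Kinv η) := by
            rw [K_vm]; simp only [smul_mul_assoc, mul_assoc]
        _ = _ := by
            rw [ih]
            simp only [smul_mul_assoc, mul_smul_comm, mul_assoc, smul_smul, hK]
    · rw [mul_smul_comm, smul_mul_assoc, smul_comm]
      congr 1
      calc K η * (Kinv η * par η (lowered η l k) * vm η) =
          (K η * Kinv η) * par η (lowered η l k) * vm η := by noncomm_ring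
        _ = Kinv η * (K η * par η (lowered η l k)) * vm η := by
            rw [← hK]; simp only [mul_assoc]
        _ = qpow η (((l - k : ℤ) : ℝ) / 2) • (Kinv η * par η (lowered η l k) * (K η * vm η)) := by
            rw [ih']; simp only [smul_mul_assoc, mul_smul_comm, mul_assoc]
        _ = _ := by
            rw [K_vm]
            simp only [mul_smul_comm, mul_assoc, smul_smul]
            rw [mul_comm]

/-- `v₊^l q^(lH)` is a highest weight vector for the adjoint action. -/
lemma ad_vp_lowered_zero {l : ℕ} (hl : Even l) : ad η (vp η) (lowered η l 0) = 0 := by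
  have hK : Kinv η * K η = K η * Kinv η := by rw [K_Kinv, Kinv_K]
  have hKl : K η ^ l * Kinv η = Kinv η * K η ^ l := ((show Commute _ _ from hK).pow_right l).symm
  rw [ad_vp, par_lowered hl, pow_zero, one_smul, lowered_zero]
  have h1 : Kinv η * (vp η ^ l * K η ^ l) * vp η =
      qpow η (-(1 / 2)) • (vp η * (vp η ^ l * K η ^ l) * Kinv η) := by
    calc Kinv η * (vp η ^ l * K η ^ l) * vp η = Kinv η * vp η ^ l * (K η ^ l * vp η) := by
          noncomm_ring
      _ = (qpow η ((l : ℝ) / 2) * qpow η (-((l : ℝ) / 2))) •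
          (vp η ^ l * (Kinv η * vp η) * K η ^ l) := by
          rw [K_pow_vp, Kinv_vp_pow]
          simp only [smul_mul_assoc, mul_smul_comm, mul_assoc, smul_smul]
      _ = qpow η (-(1 / 2)) • (vp η ^ l * vp η * (Kinv η * K η ^ l)) := by
          rw [qpow_mul_neg, one_smul, Kinv_vp]
          simp only [smul_mul_assoc, mul_smul_comm, mul_assoc]
      _ = _ := by
          rw [← hKl, ← pow_succ, pow_succ']
          simp only [mul_assoc]
  rw [h1, smul_smul, qpow_mul_neg, one_smul, sub_self]

lemma ad_vp_lowered_succ {l : ℕ} (hl : Even l) {k : ℕ} (hk : k ≤ 2 * l) :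
    ad η (vp η) (lowered η l (k + 1)) =
      ((cplus η l (l - k - 1) * cminus η l (l - k) : ℝ) : ℂ) • lowered η l k := by
  induction k with
  | zero =>
    have := ad_anticomm_of_weight (K_lowered (η := η) l 0)
    rw [ad_vp_lowered_zero hl, map_zero, add_zero, ← anticomm_coeff η l (by omega) (by omega),
      ← lowered_succ] at this
    rw [this]
    congr 2
    rw [show (l : ℤ) - (0 : ℕ) = l by simp, cplus_top]
    ring
  | succ k ih =>
    have := ad_anticomm_of_weight (K_lowered (η := η) l (k + 1))
    rw [ih (by omega), map_smul, ← anticomm_coeff η l (by omega) (by omega),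
      ← lowered_succ, ← lowered_succ, show (l : ℤ) - (k + 1 : ℕ) + 1 = l - k by push_cast; ring,
      ← eq_sub_iff_add_eq, ← sub_smul] at this
    rw [this]
    congr 1
    rw [show (l : ℤ) - k - 1 = l - (k + 1 : ℕ) by push_cast; ring]
    push_cast
    ring

end

/-! ### Matrix elements of the tensor operator -/

/-- The matrix element of `(ad v₋)^k (v₊^l q^(lH))` in `V^j` between the weights `n` and
`n + l - k`, by recursion on `k`. The values at weights outside `{-j, …, j}` carry no meaning. -/
def loweredCoeff (η : ℝ) (l j : ℕ) : ℕ → ℤ → ℝ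
  | 0, n => (∏ i ∈ Finset.range l, cplus η j (n + i)) * q η ^ ((l : ℝ) * n / 2)
  | k + 1, n => q η ^ (-((n : ℝ) / 2)) * cminus η j (n + l - k) * loweredCoeff η l j k n
      - (-1) ^ k * (q η ^ (-(1 / 2) : ℝ) * q η ^ (-(((n - 1 + l - k : ℤ) : ℝ) / 2))
        * cminus η j n) * loweredCoeff η l j k (n - 1)

section

variable {η : ℝ} {l j : ℕ}

lemma vpOp_pow_e (i : ℕ) (n : ℤ) : (vpOp η j ^ i) (e j n) =
    ((∏ k ∈ Finset.range i, cplus η j (n + k) : ℝ) : ℂ) • e j (n + i) := by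
  induction i with
  | zero => simp
  | succ i ih =>
    rw [pow_succ', Module.End.mul_apply, ih, map_smul, vpOp_e, smul_smul, Finset.prod_range_succ]
    push_cast
    rw [add_assoc]

lemma KOp_pow_e (i : ℕ) (n : ℤ) : (KOp η j ^ i) (e j n) =
    ((q η ^ ((i : ℝ) * n / 2) : ℝ) : ℂ) • e j n := by
  induction i with
  | zero => simp
  | succ i ih =>
    rw [pow_succ', Module.End.mul_apply, ih, map_smul, KOp_e, smul_smul, qpow, ← Complex.ofReal_mul,
      ← Real.rpow_add (q_pos η)]
    congr 3
    push_cast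
    ring

lemma rep_lowered_e (hl : Even l) (k : ℕ) (n : ℤ) :
    rep η j (lowered η l k) (e j n) = (loweredCoeff η l j k n : ℂ) • e j (n + l - k) := by
  induction k generalizing n with
  | zero =>
    rw [lowered_zero, map_mul, map_pow, map_pow, rep_vp, rep_K, Module.End.mul_apply, KOp_pow_e,
      map_smul, vpOp_pow_e, smul_smul, loweredCoeff]
    push_cast
    rw [sub_zero, mul_comm]
  | succ k ih =>
    have e1 : n - 1 + l - k = n + l - (k + 1 : ℕ) := by push_cast; ring
    have e2 : n + l - k - 1 = n + l - (k + 1 : ℕ) := by push_cast; ring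
    rw [lowered_succ, ad_vm, map_sub, map_smul, map_mul, map_mul, map_mul, map_mul, par_lowered hl,
      map_smul, rep_vm, rep_Kinv, loweredCoeff]
    simp only [LinearMap.sub_apply, LinearMap.smul_apply, Module.End.mul_apply, KinvOp_e, vmOp_e,
      map_smul, ih, smul_smul]
    rw [e1, e2, ← sub_smul]
    congr 1
    simp only [qpow]
    push_cast
    ring

/-- The defining recursion, multiplied by `q^(n/2)`. -/
lemma loweredCoeff_succ (k : ℕ) (n : ℤ) :
    cminus η j (n + l - k) * loweredCoeff η l j k n =
      (-1) ^ k * q η ^ (-((l - k : ℤ) : ℝ) / 2) * cminus η j n * loweredCoeff η l j k (n - 1)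
      + q η ^ ((n : ℝ) / 2) * loweredCoeff η l j (k + 1) n := by
  have h1 : q η ^ ((n : ℝ) / 2) * q η ^ (-((n : ℝ) / 2)) = 1 := by
    rw [← Real.rpow_add (q_pos η)]; simp
  have h2 : q η ^ ((n : ℝ) / 2) * (q η ^ (-(1 / 2) : ℝ) * q η ^ (-(((n - 1 + l - k : ℤ) : ℝ) / 2)))
      = q η ^ (-((l - k : ℤ) : ℝ) / 2) := by
    rw [← Real.rpow_add (q_pos η), ← Real.rpow_add (q_pos η)]; congr 1; push_cast; ring
  rw [loweredCoeff, ← h2]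
  linear_combination (-(cminus η j (n + l - k) * loweredCoeff η l j k n)) * h1

lemma rep_ad_vp_lowered_e (hl : Even l) (k : ℕ) (n : ℤ) :
    rep η j (ad η (vp η) (lowered η l k)) (e j n) =
      ((q η ^ (-((n : ℝ) / 2)) * cplus η j (n + l - k) * loweredCoeff η l j k n
      - (-1) ^ k * (q η ^ (1 / 2 : ℝ) * q η ^ (-(((n + 1 + l - k : ℤ) : ℝ) / 2))
        * cplus η j n) * loweredCoeff η l j k (n + 1) : ℝ) : ℂ) • e j (n + l - k + 1) := by
  have e1 : n + 1 + l - k = n + l - k + 1 := by ring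
  rw [ad_vp, map_sub, map_smul, map_mul, map_mul, map_mul, map_mul, par_lowered hl,
    map_smul, rep_vp, rep_Kinv]
  simp only [LinearMap.sub_apply, LinearMap.smul_apply, Module.End.mul_apply, KinvOp_e, vpOp_e,
    map_smul, rep_lowered_e hl, smul_smul]
  rw [e1, ← sub_smul]
  congr 1
  simp only [qpow]
  push_cast
  ring

lemma smul_e_inj {n : ℤ} (hn : n ∈ Set.Icc (-(j : ℤ)) j) {a b : ℝ}
    (h : (a : ℂ) • e j n = (b : ℂ) • e j n) : a = b := by
  have := congrArg (coord j n) h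
  rw [map_smul, map_smul, coord_e hn, if_pos rfl, smul_eq_mul, smul_eq_mul, mul_one, mul_one] at this
  exact_mod_cast this

lemma loweredCoeff_plus_of_eq (k : ℕ) (n : ℤ) {c : ℝ} (h :
    q η ^ (-((n : ℝ) / 2)) * cplus η j (n + l - k) * loweredCoeff η l j k n
      - (-1) ^ k * (q η ^ (1 / 2 : ℝ) * q η ^ (-(((n + 1 + l - k : ℤ) : ℝ) / 2))
        * cplus η j n) * loweredCoeff η l j k (n + 1) = c) :
    cplus η j (n + l - k) * loweredCoeff η l j k n =
      (-1) ^ k * q η ^ (-((l - k : ℤ) : ℝ) / 2) * cplus η j n * loweredCoeff η l j k (n + 1)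
      + q η ^ ((n : ℝ) / 2) * c := by
  have h1 : q η ^ ((n : ℝ) / 2) * q η ^ (-((n : ℝ) / 2)) = 1 := by
    rw [← Real.rpow_add (q_pos η)]; simp
  have h2 : q η ^ ((n : ℝ) / 2) * (q η ^ (1 / 2 : ℝ) * q η ^ (-(((n + 1 + l - k : ℤ) : ℝ) / 2)))
      = q η ^ (-((l - k : ℤ) : ℝ) / 2) := by
    rw [← Real.rpow_add (q_pos η), ← Real.rpow_add (q_pos η)]; congr 1; push_cast; ring
  rw [← h, ← h2]
  linear_combination (-(cplus η j (n + l - k) * loweredCoeff η l j k n)) * h1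

lemma loweredCoeff_plus_zero (hl : Even l) {n : ℤ} (h2 : n + l + 1 ∈ Set.Icc (-(j : ℤ)) j) :
    cplus η j (n + l) * loweredCoeff η l j 0 n =
      q η ^ (-(l : ℝ) / 2) * cplus η j n * loweredCoeff η l j 0 (n + 1) := by
  have h := rep_ad_vp_lowered_e (η := η) (j := j) hl 0 n
  rw [ad_vp_lowered_zero hl, map_zero, LinearMap.zero_apply, ← zero_smul ℂ (e j _),
    ← Complex.ofReal_zero] at h
  simpa using loweredCoeff_plus_of_eq 0 n (smul_e_inj (by simpa using h2) h).symm

lemma loweredCoeff_plus_succ (hl : Even l) {k : ℕ} (hk : k ≤ 2 * l) {n : ℤ}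
    (h2 : n + l - k ∈ Set.Icc (-(j : ℤ)) j) :
    cplus η j (n + l - (k + 1 : ℕ)) * loweredCoeff η l j (k + 1) n =
      (-1) ^ (k + 1) * q η ^ (-((l - (k + 1 : ℕ) : ℤ) : ℝ) / 2) * cplus η j n *
        loweredCoeff η l j (k + 1) (n + 1)
      + q η ^ ((n : ℝ) / 2) *
        (cplus η l (l - k - 1) * cminus η l (l - k) * loweredCoeff η l j k n) := by
  have h := rep_ad_vp_lowered_e (η := η) (j := j) hl (k + 1) n
  rw [ad_vp_lowered_succ hl hk, map_smul, LinearMap.smul_apply, rep_lowered_e hl, smul_smul,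
    show n + l - (k + 1 : ℕ) + 1 = n + l - k by push_cast; ring, ← Complex.ofReal_mul] at h
  exact loweredCoeff_plus_of_eq (k + 1) n (smul_e_inj h2 h).symm

/-- `(ad v₋)^(2l+1)` kills `v₊^l q^(lH)` in `V^j`: the result is an operator of weight `-l-1`
which commutes with `v₊` up to factors, so it vanishes on `e_j`, and then on each `e_n`. -/
lemma rep_lowered_eq_zero (hη : η ≠ 0) (hl : Even l) :
    rep η j (lowered η l (2 * l + 1)) = 0 := by
  have had : ad η (vp η) (lowered η l (2 * l + 1)) = 0 := by
    rw [ad_vp_lowered_succ hl le_rfl, show (l : ℤ) - (2 * l : ℕ) - 1 = -l - 1 by push_cast; ring,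
      cplus_bot, zero_mul, Complex.ofReal_zero, zero_smul]
  have key : ∀ i : ℕ, rep η j (lowered η l (2 * l + 1)) (e j (j + 1 - i)) = 0 := by
    intro i
    induction i with
    | zero => rw [e_of_not_mem (by push_cast; omega), map_zero]
    | succ i ih =>
      set n : ℤ := j + 1 - (i + 1 : ℕ) with hn
      have hn1 : (j : ℤ) + 1 - i = n + 1 := by rw [hn]; push_cast; ring
      rw [hn1] at ih
      have h := congrArg (fun x => rep η j x (e j n)) had
      simp only [ad_vp, map_zero, LinearMap.zero_apply] at h
      rw [map_sub, map_smul, map_mul, map_mul, map_mul, map_mul, par_lowered hl,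
        map_smul, rep_vp, rep_Kinv] at h
      simp only [LinearMap.sub_apply, LinearMap.smul_apply, Module.End.mul_apply, KinvOp_e, vpOp_e,
        map_smul, ih, smul_zero, map_zero, sub_zero] at h
      rw [rep_lowered_e hl] at h ⊢
      by_cases hr : n + l - (2 * l + 1 : ℕ) ∈ Set.Icc (-(j : ℤ)) j
      swap
      · rw [e_of_not_mem (by simpa using hr), smul_zero]
      rw [Set.mem_Icc] at hr
      have hc := cplus_ne_zero (l := j) hη hr.1 (by push_cast; omega)
      have hq := (Real.rpow_pos_of_pos (q_pos η) (-((n : ℝ) / 2))).ne'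
      rw [map_smul, vpOp_e, smul_smul, smul_smul, qpow, ← Complex.ofReal_mul,
        ← Complex.ofReal_mul, ← zero_smul ℂ (e j _), ← Complex.ofReal_zero] at h
      have := smul_e_inj (by rw [Set.mem_Icc]; push_cast at hr ⊢; omega) h
      have h0 : loweredCoeff η l j (2 * l + 1) n = 0 := by
        push_cast at hc
        simpa [hc, hq] using this
      rw [h0, Complex.ofReal_zero, zero_smul]
  refine end_ext fun n h1 h2 => ?_
  have := key (j + 1 - n).toNat
  rwa [show (j : ℤ) + 1 - ((j + 1 - n).toNat : ℕ) = n by omega] at this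

lemma loweredCoeff_eq_zero (hη : η ≠ 0) (hl : Even l) {n : ℤ}
    (hn : n - l - 1 ∈ Set.Icc (-(j : ℤ)) j) : loweredCoeff η l j (2 * l + 1) n = 0 := by
  have h := rep_lowered_e (η := η) (j := j) hl (2 * l + 1) n
  rw [rep_lowered_eq_zero hη hl, LinearMap.zero_apply, ← zero_smul ℂ (e j _),
    ← Complex.ofReal_zero, show n + l - (2 * l + 1 : ℕ) = n - l - 1 by push_cast; ring] at h
  exact (smul_e_inj hn h).symm

/-! ### The normalization of the tensor operator -/

/-- The scalar with `v₋^k e_l = lowerNorm η l k • e_(l-k)` in `V^l`. -/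
def lowerNorm (η : ℝ) (l k : ℕ) : ℝ := ∏ i ∈ Finset.range k, cminus η l (l - i)

lemma lowerNorm_succ (k : ℕ) : lowerNorm η l (k + 1) = lowerNorm η l k * cminus η l (l - k) :=
  Finset.prod_range_succ _ _

lemma lowerNorm_pos (hη : η ≠ 0) {k : ℕ} (hk : k ≤ 2 * l) : 0 < lowerNorm η l k :=
  Finset.prod_pos fun i hi => cminus_pos hη (by have := Finset.mem_range.1 hi; omega) (by omega)

lemma qfact_succ (n : ℕ) : qfact η (n + 1) = qfact η n * qnum η (n + 1) :=
  Finset.prod_range_succ _ _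

lemma qfact_ne_zero (hη : η ≠ 0) (n : ℕ) : qfact η n ≠ 0 :=
  Finset.prod_ne_zero_iff.2 fun i _ => qnum_ne_zero hη (by omega)

/-- Up to an inverse, `lowerNorm η l k ^ 2` is the radicand in the definition of `t^l_(l-k)`. -/
lemma qfact_mul_lowerNorm_sq (hη : η ≠ 0) {k : ℕ} (hk : k ≤ 2 * l) :
    qfact η (2 * l - k) * lowerNorm η l k ^ 2 = qfact η (2 * l) * qfact η k * gam η ^ k := by
  induction k with
  | zero => simp [lowerNorm, qfact]
  | succ k ih =>
    have h := ih (by omega)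
    obtain ⟨d, hd⟩ : ∃ d, 2 * l - k = d + 1 := ⟨2 * l - k - 1, by omega⟩
    rw [hd, qfact_succ] at h
    rw [show 2 * l - (k + 1) = d by omega, lowerNorm_succ, mul_pow,
      cminus_sq hη (by omega) (by omega), qfact_succ, pow_succ,
      show (l : ℤ) + (l - k) = d + 1 by omega, show (l : ℤ) - (l - k) + 1 = k + 1 by ring]
    linear_combination (qnum η (k + 1) * gam η) * h

lemma t_eq (hη : η ≠ 0) (p : Weight l) :
    t η l p = (((lowerNorm η l (l - p : ℤ).toNat)⁻¹ : ℝ) : ℂ) • lowered η l (l - p : ℤ).toNat := by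
  obtain ⟨p, hp⟩ := p
  rw [Set.mem_Icc] at hp
  have hk : (l - p : ℤ).toNat ≤ 2 * l := by omega
  have h := qfact_mul_lowerNorm_sq hη hk
  have hpos := lowerNorm_pos hη hk
  simp only [t, lowered]
  rw [show (l + p : ℤ).toNat = 2 * l - (l - p : ℤ).toNat by omega]
  generalize (l - p : ℤ).toNat = k at *
  congr 2
  rw [← h, Real.sqrt_eq_iff_eq_sq, inv_pow]
  · have := qfact_ne_zero hη (2 * l - k)
    field_simp
  · have := qfact_ne_zero hη (2 * l - k)
    rw [div_mul_cancel_left₀ this]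
    positivity
  · positivity

/-- The matrix element of `t^l_p` in `V^j` between the weights `n` and `n + p`, extended by zero
to all integers. -/
def tensorCoeff (η : ℝ) (l j : ℕ) (p n : ℤ) : ℝ :=
  if p ∈ Set.Icc (-(l : ℤ)) l ∧ n ∈ Set.Icc (-(j : ℤ)) j ∧ n + p ∈ Set.Icc (-(j : ℤ)) j then
    loweredCoeff η l j (l - p : ℤ).toNat n / lowerNorm η l (l - p : ℤ).toNat
  else 0

lemma tensorCoeff_of_not_mem {p n : ℤ} (h : ¬ (p ∈ Set.Icc (-(l : ℤ)) l ∧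
    n ∈ Set.Icc (-(j : ℤ)) j ∧ n + p ∈ Set.Icc (-(j : ℤ)) j)) : tensorCoeff η l j p n = 0 :=
  if_neg h

lemma tensorCoeff_sub {k : ℕ} (hk : k ≤ 2 * l) {n : ℤ} (h1 : n ∈ Set.Icc (-(j : ℤ)) j)
    (h2 : n + l - k ∈ Set.Icc (-(j : ℤ)) j) :
    tensorCoeff η l j (l - k) n = loweredCoeff η l j k n / lowerNorm η l k := by
  rw [tensorCoeff, if_pos, show ((l : ℤ) - (l - k)).toNat = k by omega]
  refine ⟨?_, h1, ?_⟩
  · rw [Set.mem_Icc]; omega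
  · rwa [← add_sub_assoc]

lemma toMatrix_rep_t (hη : η ≠ 0) (hl : Even l) (p : Weight l) (m n : Weight j) :
    LinearMap.toMatrix' (rep η j (t η l p)) m n =
      ((if (n : ℤ) + p = m then tensorCoeff η l j p n else 0 : ℝ) : ℂ) := by
  have hp := p.2
  rw [Set.mem_Icc] at hp
  have hcol : LinearMap.toMatrix' (rep η j (t η l p)) m n =
      coord j m (rep η j (t η l p) (e j n)) := by
    rw [coord_of_mem, e_coe, LinearMap.toMatrix'_apply, Pi.basisFun_apply]
  rw [hcol, t_eq hη, map_smul, LinearMap.smul_apply, rep_lowered_e hl, map_smul, map_smul, coord_e m.2,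
    show (n : ℤ) + l - ((l - p : ℤ).toNat : ℕ) = n + p by omega]
  by_cases h : (n : ℤ) + p = m
  · rw [if_pos h.symm, if_pos h, tensorCoeff, if_pos ⟨p.2, n.2, h ▸ m.2⟩]
    simp only [smul_eq_mul]
    push_cast
    rw [mul_one, div_eq_inv_mul]
  · rw [if_neg (Ne.symm h), if_neg h]
    simp

/-- `t^l_p` transforms under `ad v₋` as the basis vector `e_p` of `V^l` under `v₋`. -/
lemma tensorCoeff_minus (hη : η ≠ 0) (hl : Even l) (p n : ℤ) :
    cminus η j (n + p) * tensorCoeff η l j p n =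
      (-1) ^ p * q η ^ (-(p : ℝ) / 2) * cminus η j n * tensorCoeff η l j p (n - 1)
      + q η ^ ((n : ℝ) / 2) * cminus η l p * tensorCoeff η l j (p - 1) n := by
  by_cases hp : p ∈ Set.Icc (-(l : ℤ)) l
  swap
  · rw [tensorCoeff_of_not_mem (p := p) (fun h => hp h.1),
      tensorCoeff_of_not_mem (p := p) (fun h => hp h.1)]
    rcases eq_or_ne p (l + 1) with rfl | h
    · rw [cminus_top]; ring
    · rw [tensorCoeff_of_not_mem (p := p - 1)]
      · ring
      · simp only [Set.mem_Icc] at *; omega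
  by_cases hn : n ∈ Set.Icc (-(j : ℤ)) j
  swap
  · rw [tensorCoeff_of_not_mem (n := n) (fun h => hn h.2.1),
      tensorCoeff_of_not_mem (n := n) (fun h => hn h.2.1)]
    rcases eq_or_ne n (j + 1) with rfl | h
    · rw [cminus_top]; ring
    · rw [tensorCoeff_of_not_mem (n := n - 1)]
      · ring
      · simp only [Set.mem_Icc] at *; omega
  by_cases hr : n + p - 1 ∈ Set.Icc (-(j : ℤ)) j
  swap
  · rw [tensorCoeff_of_not_mem (n := n - 1), tensorCoeff_of_not_mem (p := p - 1)]
    · rcases eq_or_ne (n + p) (-j) with h | h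
      · rw [h, cminus_bot]; ring
      · rw [tensorCoeff_of_not_mem]
        · ring
        · simp only [Set.mem_Icc] at *; omega
    · simp only [Set.mem_Icc] at *; omega
    · simp only [Set.mem_Icc] at *; omega
  obtain ⟨k, rfl⟩ : ∃ k : ℕ, p = l - k := ⟨(l - p : ℤ).toNat, by
    simp only [Set.mem_Icc] at hp; omega⟩
  simp only [Set.mem_Icc] at hp hn hr
  have hk : k ≤ 2 * l := by omega
  have hD := lowerNorm_pos hη hk
  have a1 : cminus η j (n + (l - k)) * tensorCoeff η l j (l - k) n =
      cminus η j (n + (l - k)) * loweredCoeff η l j k n / lowerNorm η l k := by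
    rcases eq_or_ne (n + (l - k : ℤ)) (j + 1) with h | h
    · rw [h, cminus_top]; ring
    · rw [tensorCoeff_sub hk]
      · ring
      all_goals simp only [Set.mem_Icc]; omega
  have a2 : cminus η j n * tensorCoeff η l j (l - k) (n - 1) =
      cminus η j n * loweredCoeff η l j k (n - 1) / lowerNorm η l k := by
    rcases eq_or_ne n (-j) with h | h
    · rw [h, cminus_bot]; ring
    · rw [tensorCoeff_sub hk]
      · ring
      all_goals simp only [Set.mem_Icc]; omega
  have a3 : cminus η l (l - k) * tensorCoeff η l j (l - k - 1) n =
      loweredCoeff η l j (k + 1) n / lowerNorm η l k := by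
    rcases eq_or_ne k (2 * l) with h | h
    · subst h
      rw [loweredCoeff_eq_zero hη hl, show (l : ℤ) - (2 * l : ℕ) = -l by push_cast; ring,
        cminus_bot]
      · ring
      · simp only [Set.mem_Icc]; push_cast at hr; omega
    · have hc := (cminus_pos hη (l := l) (m := l - k) (by omega) (by omega)).ne'
      rw [show (l : ℤ) - k - 1 = l - (k + 1 : ℕ) by push_cast; ring,
        tensorCoeff_sub (by omega), lowerNorm_succ]
      · field_simp
      all_goals simp only [Set.mem_Icc]; omega
  have h := loweredCoeff_succ (η := η) (l := l) (j := j) k n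
  have hs : (-1 : ℝ) ^ ((l : ℤ) - k) = (-1) ^ k := by
    rw [neg_one_zpow_sub, zpow_natCast, zpow_natCast, hl.neg_one_pow, one_mul]
  rw [hs, a1, mul_assoc _ (cminus η j n), a2, mul_assoc _ (cminus η l _), a3, ← add_sub_assoc, h]
  push_cast
  ring

/-- `t^l_p` transforms under `ad v₊` as the basis vector `e_p` of `V^l` under `v₊`. -/
lemma tensorCoeff_plus (hη : η ≠ 0) (hl : Even l) (p n : ℤ) :
    cplus η j (n + p) * tensorCoeff η l j p n =
      (-1) ^ p * q η ^ (-(p : ℝ) / 2) * cplus η j n * tensorCoeff η l j p (n + 1)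
      + q η ^ ((n : ℝ) / 2) * cplus η l p * tensorCoeff η l j (p + 1) n := by
  by_cases hp : p ∈ Set.Icc (-(l : ℤ)) l
  swap
  · rw [tensorCoeff_of_not_mem (p := p) (fun h => hp h.1),
      tensorCoeff_of_not_mem (p := p) (fun h => hp h.1)]
    rcases eq_or_ne p (-l - 1) with rfl | h
    · rw [cplus_bot]; ring
    · rw [tensorCoeff_of_not_mem (p := p + 1)]
      · ring
      · simp only [Set.mem_Icc] at *; omega
  by_cases hn : n ∈ Set.Icc (-(j : ℤ)) j
  swap
  · rw [tensorCoeff_of_not_mem (n := n) (fun h => hn h.2.1),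
      tensorCoeff_of_not_mem (n := n) (fun h => hn h.2.1)]
    rcases eq_or_ne n (-j - 1) with rfl | h
    · rw [cplus_bot]; ring
    · rw [tensorCoeff_of_not_mem (n := n + 1)]
      · ring
      · simp only [Set.mem_Icc] at *; omega
  by_cases hr : n + p + 1 ∈ Set.Icc (-(j : ℤ)) j
  swap
  · rw [tensorCoeff_of_not_mem (n := n + 1), tensorCoeff_of_not_mem (p := p + 1)]
    · rcases eq_or_ne (n + p) j with h | h
      · rw [h, cplus_top]; ring
      · rw [tensorCoeff_of_not_mem]
        · ring
        · simp only [Set.mem_Icc] at *; omega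
    · simp only [Set.mem_Icc] at *; omega
    · simp only [Set.mem_Icc] at *; omega
  obtain ⟨k, rfl⟩ : ∃ k : ℕ, p = l - k := ⟨(l - p : ℤ).toNat, by
    simp only [Set.mem_Icc] at hp; omega⟩
  simp only [Set.mem_Icc] at hp hn hr
  have hk : k ≤ 2 * l := by omega
  have hD := lowerNorm_pos hη hk
  have a1 : cplus η j (n + (l - k)) * tensorCoeff η l j (l - k) n =
      cplus η j (n + (l - k)) * loweredCoeff η l j k n / lowerNorm η l k := by
    rcases eq_or_ne (n + (l - k : ℤ)) (-j - 1) with h | h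
    · rw [h, cplus_bot]; ring
    · rw [tensorCoeff_sub hk]
      · ring
      all_goals simp only [Set.mem_Icc]; omega
  have a2 : cplus η j n * tensorCoeff η l j (l - k) (n + 1) =
      cplus η j n * loweredCoeff η l j k (n + 1) / lowerNorm η l k := by
    rcases eq_or_ne n j with h | h
    · rw [h, cplus_top]; ring
    · rw [tensorCoeff_sub hk]
      · ring
      all_goals simp only [Set.mem_Icc]; omega
  have hs : (-1 : ℝ) ^ ((l : ℤ) - k) = (-1) ^ k := by
    rw [neg_one_zpow_sub, zpow_natCast, zpow_natCast, hl.neg_one_pow, one_mul]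
  rw [hs, a1, mul_assoc _ (cplus η j n), a2, ← add_sub_assoc]
  cases k with
  | zero =>
    have h := loweredCoeff_plus_zero (η := η) (j := j) hl (n := n)
      (by simp only [Set.mem_Icc]; push_cast at hr; omega)
    rw [show n + l - (0 : ℕ) = n + l by simp, show (l : ℤ) - (0 : ℕ) = l by simp, cplus_top, h]
    push_cast
    ring
  | succ k =>
    have h := loweredCoeff_plus_succ (η := η) (j := j) hl (k := k) (n := n) (by omega)
      (by simp only [Set.mem_Icc]; push_cast at hr; omega)
    have hc := (cminus_pos hη (l := l) (m := l - k) (by omega) (by omega)).ne'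
    have hD' := (lowerNorm_pos hη (l := l) (k := k) (by omega)).ne'
    rw [h, show (l : ℤ) - (k + 1 : ℕ) + 1 = l - k by push_cast; ring,
      tensorCoeff_sub (k := k) (by omega), lowerNorm_succ,
      show (l : ℤ) - (k + 1 : ℕ) = l - k - 1 by push_cast; ring]
    · push_cast
      field_simp
    all_goals simp only [Set.mem_Icc]; push_cast at hr; omega

end

/-! ### Gaussian binomial coefficients -/

/-- The Gaussian number `1 + Q + ⋯ + Q^(n-1)`. -/
def gaussNum (Q : ℝ) (n : ℕ) : ℝ := ∑ i ∈ Finset.range n, Q ^ i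

/-- The Gaussian factorial. -/
def gaussFact (Q : ℝ) (n : ℕ) : ℝ := ∏ i ∈ Finset.range n, gaussNum Q (i + 1)

/-- The Gaussian binomial coefficient `a + k` over `k`, for `Q` such that the Gaussian
factorials do not vanish. -/
def gaussBinom (Q : ℝ) (a k : ℕ) : ℝ :=
  gaussFact Q (a + k) / (gaussFact Q a * gaussFact Q k)

lemma gaussNum_add (Q : ℝ) (a b : ℕ) : gaussNum Q (a + b) = gaussNum Q a + Q ^ a * gaussNum Q b := by
  rw [gaussNum, gaussNum, gaussNum, Finset.sum_range_add, Finset.mul_sum]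
  simp only [pow_add]

lemma gaussFact_succ (Q : ℝ) (n : ℕ) :
    gaussFact Q (n + 1) = gaussFact Q n * gaussNum Q (n + 1) :=
  Finset.prod_range_succ _ _

section

variable {Q : ℝ}

lemma gaussFact_ne_zero (hQ : ∀ n, gaussNum Q (n + 1) ≠ 0)
    (n : ℕ) : gaussFact Q n ≠ 0 :=
  Finset.prod_ne_zero_iff.2 fun i _ => hQ i

lemma gaussBinom_zero_right (hQ : ∀ n, gaussNum Q (n + 1) ≠ 0)
    (a : ℕ) : gaussBinom Q a 0 = 1 := by
  have := gaussFact_ne_zero hQ a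
  simp [gaussBinom, gaussFact] at *
  exact this

lemma gaussBinom_zero_left (hQ : ∀ n, gaussNum Q (n + 1) ≠ 0)
    (k : ℕ) : gaussBinom Q 0 k = 1 := by
  have := gaussFact_ne_zero hQ k
  rw [gaussBinom, zero_add, show gaussFact Q 0 = 1 from rfl, one_mul, div_self this]

lemma gaussBinom_succ_right (hQ : ∀ n, gaussNum Q (n + 1) ≠ 0)
    (a k : ℕ) :
    gaussBinom Q a (k + 1) * gaussNum Q (k + 1) = gaussBinom Q a k * gaussNum Q (a + k + 1) := by
  have h1 := gaussFact_ne_zero hQ a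
  have h2 := gaussFact_ne_zero hQ k
  have h3 := hQ k
  rw [gaussBinom, gaussBinom, ← add_assoc, gaussFact_succ, gaussFact_succ]
  field_simp

lemma gaussBinom_succ_succ (hQ : ∀ n, gaussNum Q (n + 1) ≠ 0)
    (a k : ℕ) : gaussBinom Q (a + 1) (k + 1) =
    gaussBinom Q a (k + 1) + Q ^ (a + 1) * gaussBinom Q (a + 1) k := by
  have h1 := gaussFact_ne_zero hQ a
  have h2 := gaussFact_ne_zero hQ k
  have h3 := hQ k
  have h4 := hQ a
  have e : gaussNum Q (a + k + 1 + 1) = gaussNum Q (a + 1) + Q ^ (a + 1) * gaussNum Q (k + 1) := by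
    rw [← gaussNum_add]; congr 1; ring
  rw [gaussBinom, gaussBinom, gaussBinom, show a + 1 + (k + 1) = a + k + 1 + 1 by ring,
    show a + (k + 1) = a + k + 1 by ring, show a + 1 + k = a + k + 1 by ring,
    gaussFact_succ Q (a + k + 1), gaussFact_succ Q a, gaussFact_succ Q k, e]
  field_simp

/-- The `Q`-Vandermonde identity for the coefficients of `1 / ((1 - x) (1 - Q x) ⋯ (1 - Q^a x))`. -/
lemma sum_gaussBinom (hQ : ∀ n, gaussNum Q (n + 1) ≠ 0)
    (a b c : ℕ) :
    ∑ i ∈ Finset.range (c + 1), Q ^ ((a + 1) * i) * gaussBinom Q a (c - i) * gaussBinom Q b i =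
      gaussBinom Q (a + b + 1) c := by
  induction c generalizing b with
  | zero => simp [gaussBinom_zero_right hQ]
  | succ c ih =>
    induction b with
    | zero =>
      have h := ih 0
      simp only [gaussBinom_zero_left hQ, mul_one, add_zero] at h ⊢
      rw [Finset.sum_range_succ', gaussBinom_succ_succ hQ, ← h,
        Finset.mul_sum, add_comm]
      simp only [mul_zero, pow_zero, one_mul, Nat.sub_zero, Nat.add_sub_add_right]
      congr 1
      refine Finset.sum_congr rfl fun i _ => ?_
      rw [mul_add, pow_add, mul_one]
      ring
    | succ b ihb =>
      have h := ih (b + 1)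
      rw [Finset.sum_range_succ'] at ihb ⊢
      rw [show a + (b + 1) + 1 = a + b + 1 + 1 by ring] at *
      rw [gaussBinom_succ_succ hQ, ← ihb, ← h, Finset.mul_sum, add_right_comm,
        ← Finset.sum_add_distrib, gaussBinom_zero_right hQ, gaussBinom_zero_right hQ]
      congr 1
      refine Finset.sum_congr rfl fun i _ => ?_
      rw [gaussBinom_succ_succ hQ, Nat.add_sub_add_right]
      ring

end

/-! ### The super `q`-numbers as Gaussian numbers -/

section

variable {η : ℝ}

/-- The super `q`-number `[n]` is the Gaussian number at `Q = -q`, up to a power of `q`. -/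
lemma qnum_eq_gaussNum (n : ℕ) :
    qnum η n = q η ^ (-((n : ℝ) - 1) / 2) * gaussNum (-q η) n := by
  have hq := q_pos η
  have hg : gaussNum (-q η) n * (1 + q η) = 1 - (-q η) ^ n := by
    have := geom_sum_mul (-q η) n
    rw [gaussNum]
    linear_combination -this
  have hn : q η ^ n = q η ^ ((n : ℝ) / 2) * q η ^ ((n : ℝ) / 2) := by
    rw [← Real.rpow_add hq, add_halves, Real.rpow_natCast]
  have h1 : q η ^ (-(n : ℝ) / 2) * q η ^ ((n : ℝ) / 2) = 1 := by
    rw [← Real.rpow_add hq, neg_div, neg_add_cancel, Real.rpow_zero]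
  have h2 : q η ^ (-((n : ℝ) - 1) / 2) = q η ^ (-(n : ℝ) / 2) * q η ^ (1 / 2 : ℝ) := by
    rw [← Real.rpow_add hq]; congr 1; ring
  have h3 : q η ^ (1 / 2 : ℝ) * q η ^ (-(1 / 2) : ℝ) = 1 := by
    rw [← Real.rpow_add hq]; simp
  have h4 : q η ^ (1 / 2 : ℝ) * q η ^ (1 / 2 : ℝ) = q η := by
    rw [← Real.rpow_add hq]; norm_num
  have hpos : 0 < q η ^ (-(1 / 2) : ℝ) + q η ^ (1 / 2 : ℝ) := by positivity
  rw [qnum, div_eq_iff hpos.ne', h2, zpow_natCast]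
  push_cast
  rw [neg_pow, hn] at hg
  linear_combination (-(q η ^ (-(n : ℝ) / 2))) * hg
    - q η ^ (-(n : ℝ) / 2) * gaussNum (-q η) n * (h3 + h4)
    + (-1) ^ n * q η ^ ((n : ℝ) / 2) * h1

lemma gaussNum_neg_q_ne_zero (hη : η ≠ 0) (n : ℕ) : gaussNum (-q η) (n + 1) ≠ 0 := by
  have h := qnum_ne_zero hη (n := ((n + 1 : ℕ) : ℤ)) (by omega)
  rw [qnum_eq_gaussNum] at h
  exact right_ne_zero_of_mul h

lemma qfact_eq_gaussFact (n : ℕ) :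
    qfact η n = q η ^ (-((n : ℝ) * (n - 1)) / 4) * gaussFact (-q η) n := by
  induction n with
  | zero => simp [qfact, gaussFact]
  | succ n ih =>
    have h := qnum_eq_gaussNum (η := η) (n + 1)
    push_cast at h
    rw [qfact_succ, gaussFact_succ, ih, h,
      show -(((n + 1 : ℕ) : ℝ) * (((n + 1 : ℕ) : ℝ) - 1)) / 4 =
        -((n : ℝ) * (n - 1)) / 4 + -((n : ℝ) + 1 - 1) / 2 by push_cast; ring,
      Real.rpow_add (q_pos η)]
    ring

/-- The sign of `[n]!` is that of `γ^(n/2)`, with the integral part of `n/2`. -/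
lemma qfact_mul_gam_pow_pos (hη : η ≠ 0) (n : ℕ) : 0 < qfact η n * gam η ^ (n / 2) := by
  induction n with
  | zero => simp [qfact]
  | succ n ih =>
    rw [qfact_succ]
    rcases Nat.even_or_odd n with h | h
    · rw [Nat.succ_div_of_not_dvd (by rw [← even_iff_two_dvd]; simpa [Nat.even_add_one] using h)]
      have h1 : 0 < qnum η (n + 1) := by
        rw [qnum_odd η (by exact_mod_cast h.add_one)]
        exact div_pos (Real.cosh_pos _) (Real.cosh_pos _)
      calc 0 < qfact η n * gam η ^ (n / 2) * qnum η (n + 1) := mul_pos ih h1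
        _ = _ := by ring
    · rw [Nat.succ_div_of_dvd (by rw [← even_iff_two_dvd]; exact h.add_one)]
      have h1 : 0 < qnum η (n + 1) * gam η := by
        refine lt_of_le_of_ne ?_ (mul_ne_zero (qnum_ne_zero hη (by omega)) (gam_ne_zero hη)).symm
        have := qnum_mul_nonneg η (a := n + 1) (b := 1) (by omega) (by omega)
          (by exact_mod_cast h.add_one.add_one)
        rwa [qnum_odd η (n := 1) odd_one, Int.cast_one, mul_one,
          div_self (Real.cosh_pos _).ne', mul_one] at this
      calc 0 < qfact η n * gam η ^ (n / 2) * (qnum η (n + 1) * gam η) := mul_pos ih h1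
        _ = _ := by ring

/-! ### The square of the reduced matrix element -/

variable {l j : ℕ}

/-- For `η < 0` both the `q`-factorials and `γ` may be negative, but the radicand in the reduced
matrix element is positive. -/
lemma alpha_radicand_pos (hη : η ≠ 0) (hl : Even l) (hlj : l ≤ 2 * j) :
    0 < qfact η (2 * j + l + 1) * gam η ^ l /
      (qfact η (2 * l) * qfact η (2 * j - l) * qnum η (2 * j + 1)) := by
  obtain ⟨h, rfl⟩ := hl
  have hg := gam_ne_zero hη
  have h1 := qfact_mul_gam_pow_pos hη (2 * j + (h + h) + 1)
  have h2 := qfact_mul_gam_pow_pos hη (2 * (h + h))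
  have h3 := qfact_mul_gam_pow_pos hη (2 * j - (h + h))
  rw [show (2 * j + (h + h) + 1) / 2 = (h + h) + (j - h) by omega] at h1
  rw [show 2 * (h + h) / 2 = h + h by omega] at h2
  rw [show (2 * j - (h + h)) / 2 = j - h by omega] at h3
  have h4 : 0 < qnum η (2 * j + 1) := by
    rw [qnum_odd η (odd_two_mul_add_one _)]
    exact div_pos (Real.cosh_pos _) (Real.cosh_pos _)
  have h5 : 0 < gam η ^ (h + h) := (Even.add_self h).pow_pos hg
  have e : qfact η (2 * j + (h + h) + 1) * gam η ^ (h + h) /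
      (qfact η (2 * (h + h)) * qfact η (2 * j - (h + h)) * qnum η (2 * j + 1)) =
      qfact η (2 * j + (h + h) + 1) * gam η ^ (h + h + (j - h)) /
        (qfact η (2 * (h + h)) * gam η ^ (h + h) * (qfact η (2 * j - (h + h)) * gam η ^ (j - h))) *
        (gam η ^ (h + h) / qnum η (2 * j + 1)) := by
    have := qfact_ne_zero hη (2 * (h + h))
    have := qfact_ne_zero hη (2 * j - (h + h))
    rw [pow_add (gam η) (h + h) (j - h)]
    field_simp
  rw [e]
  exact mul_pos (div_pos h1 (mul_pos h2 h3)) (div_pos h5 h4)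

lemma alpha_sq (hη : η ≠ 0) (hl : Even l) (hlj : l ≤ 2 * j) :
    alpha η l j ^ 2 = q η ^ (-((l : ℝ) * (l + 1)) / 2) * qfact η l ^ 2 *
      (qfact η (2 * j + l + 1) * gam η ^ l /
      (qfact η (2 * l) * qfact η (2 * j - l) * qnum η (2 * j + 1))) := by
  rw [alpha, mul_pow, Real.sq_sqrt (alpha_radicand_pos hη hl hlj).le, mul_pow, mul_pow, ← pow_mul,
    (even_two.mul_left _).neg_one_pow, one_mul, sq_abs, pow_two (q η ^ _),
    ← Real.rpow_add (q_pos η)]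
  congr 3
  ring_nf

lemma qfact_eq_prod_sub (n : ℕ) : qfact η n = ∏ i ∈ Finset.range n, qnum η (n - i) := by
  rw [qfact, ← Finset.prod_range_reflect]
  refine Finset.prod_congr rfl fun i hi => ?_
  have := Finset.mem_range.1 hi
  congr 1
  omega

lemma qfact_add (a k : ℕ) :
    qfact η (a + k) = qfact η a * ∏ i ∈ Finset.range k, qnum η (a + i + 1) := by
  rw [qfact, Finset.prod_range_add, qfact]
  push_cast
  rfl

lemma tensorCoeff_top (hlj : l ≤ 2 * j) : tensorCoeff η l j l (j - l) =
    (∏ i ∈ Finset.range l, cplus η j (j - l + i)) * q η ^ ((l : ℝ) * (j - l) / 2) := by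
  have h := tensorCoeff_sub (η := η) (l := l) (j := j) (k := 0) (by omega) (n := j - l)
    (by rw [Set.mem_Icc]; omega) (by rw [Set.mem_Icc]; push_cast; omega)
  rw [show (l : ℤ) - (0 : ℕ) = l by simp] at h
  rw [h, loweredCoeff, lowerNorm, Finset.prod_range_zero, div_one]
  push_cast
  rfl

lemma tensorCoeff_top_sq (hη : η ≠ 0) (hlj : l ≤ 2 * j) : tensorCoeff η l j l (j - l) ^ 2 =
    q η ^ ((l : ℝ) * (j - l)) * gam η ^ l * qfact η l * (qfact η (2 * j) / qfact η (2 * j - l)) := by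
  obtain ⟨a, ha⟩ : ∃ a, 2 * j = a + l := ⟨2 * j - l, by omega⟩
  have hf := qfact_ne_zero hη a
  have hp : ∀ i ∈ Finset.range l, cplus η j (j - l + i) ^ 2 =
      qnum η (a + i + 1) * qnum η (l - i) * gam η := by
    intro i hi
    have := Finset.mem_range.1 hi
    rw [cplus_eq, mul_pow, pow_two ((-1 : ℝ) ^ _), neg_one_zpow_mul_self, one_mul,
      cminus_sq hη (by omega) (by omega)]
    congr 3 <;> omega
  rw [tensorCoeff_top hlj, mul_pow, ← Finset.prod_pow, Finset.prod_congr rfl hp,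
    Finset.prod_mul_distrib, Finset.prod_mul_distrib, Finset.prod_const, Finset.card_range,
    ← qfact_eq_prod_sub, pow_two (q η ^ _), ← Real.rpow_add (q_pos η), add_halves, ha,
    show a + l - l = a by omega, qfact_add, mul_div_cancel_left₀ _ hf]
  ring

lemma alpha_sq_eq (hη : η ≠ 0) (hl : Even l) (hlj : l ≤ 2 * j) :
    alpha η l j ^ 2 * ((-q η) ^ ((2 * j - l + 1) * l) * gaussBinom (-q η) l l) =
      tensorCoeff η l j l (j - l) ^ 2 * gaussBinom (-q η) (2 * j + 1) l := by
  obtain ⟨a, ha⟩ : ∃ a, 2 * j = a + l := ⟨2 * j - l, by omega⟩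
  have haR : 2 * (j : ℝ) = a + l := by exact_mod_cast ha
  have hQ := gaussNum_neg_q_ne_zero hη
  have hfl := qfact_ne_zero hη l
  have hfa := qfact_ne_zero hη a
  have hnum : qnum η (2 * j + 1) ≠ 0 := qnum_ne_zero hη (by omega)
  have hg := gam_ne_zero hη
  have e1 : qfact η (2 * j) * qnum η (2 * j + 1) = qfact η (2 * j + 1) := by
    rw [qfact_succ]; push_cast; rfl
  have hpow : (-q η) ^ ((2 * j - l + 1) * l) = q η ^ (((a : ℝ) + 1) * l) := by
    rw [Even.neg_pow (hl.mul_left _), show 2 * j - l + 1 = a + 1 by omega, ← Real.rpow_natCast]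
    push_cast
    rfl
  have hf2l := qfact_ne_zero hη (2 * l)
  have hf2j := qfact_ne_zero hη (2 * j + 1)
  rw [alpha_sq hη hl hlj, tensorCoeff_top_sq hη hlj, hpow, gaussBinom, gaussBinom, ← two_mul l,
    show 2 * j - l = a by omega, show 2 * j + 1 + l = 2 * j + l + 1 by ring]
  have g1 := gaussFact_ne_zero hQ l
  have g2 := gaussFact_ne_zero hQ (2 * l)
  have g3 := gaussFact_ne_zero hQ (2 * j + 1)
  have key : q η ^ (-((l : ℝ) * (l + 1)) / 2) * q η ^ (((a : ℝ) + 1) * l) * qfact η l *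
        qfact η (2 * j + l + 1) * gaussFact (-q η) (2 * l) * gaussFact (-q η) (2 * j + 1)
      = q η ^ ((l : ℝ) * (j - l)) * qfact η (2 * j + 1) * gaussFact (-q η) (2 * j + l + 1) *
        qfact η (2 * l) * gaussFact (-q η) l := by
    rw [qfact_eq_gaussFact, qfact_eq_gaussFact (2 * j + l + 1), qfact_eq_gaussFact (2 * j + 1),
      qfact_eq_gaussFact (2 * l)]
    have hexp : q η ^ (-((l : ℝ) * (l + 1)) / 2) * q η ^ (((a : ℝ) + 1) * l) *
        q η ^ (-((l : ℝ) * (l - 1)) / 4) *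
        q η ^ (-(((2 * j + l + 1 : ℕ) : ℝ) * (((2 * j + l + 1 : ℕ) : ℝ) - 1)) / 4) =
        q η ^ ((l : ℝ) * (j - l)) *
        q η ^ (-(((2 * j + 1 : ℕ) : ℝ) * (((2 * j + 1 : ℕ) : ℝ) - 1)) / 4) *
        q η ^ (-(((2 * l : ℕ) : ℝ) * (((2 * l : ℕ) : ℝ) - 1)) / 4) := by
      simp only [← Real.rpow_add (q_pos η)]
      congr 1
      push_cast
      rw [show (a : ℝ) = 2 * j - l by linarith]
      ring
    linear_combination (gaussFact (-q η) l * gaussFact (-q η) (2 * j + l + 1) *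
      gaussFact (-q η) (2 * l) * gaussFact (-q η) (2 * j + 1)) * hexp
  rw [← e1] at key
  generalize q η ^ (-((l : ℝ) * (l + 1)) / 2) = u₁ at *
  generalize q η ^ (((a : ℝ) + 1) * l) = u₂ at *
  generalize q η ^ ((l : ℝ) * (j - l)) = u₃ at *
  field_simp
  linear_combination key

/-! ### The normalization sums -/

/-- The recursion for the components of the highest weight vector of weight `j` in `V^l ⊗ V^j`, squared
and written in Gaussian numbers. The sign comes from `Q^(2j-l+1) = -q^(2j-l+1)`. -/
lemma tensorCoeff_highest (hη : η ≠ 0) (hl : Even l) (hlj : l ≤ 2 * j) {i : ℕ} (hi : i < l) :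
    (-q η) ^ (2 * j - l + 1) * (gaussNum (-q η) (l + i + 1) * gaussNum (-q η) (l - i)) *
        tensorCoeff η l j i (j - i) ^ 2 =
      -(gaussNum (-q η) (2 * j - i) * gaussNum (-q η) (i + 1) *
        tensorCoeff η l j (i + 1) (j - (i + 1)) ^ 2) := by
  have hq := q_pos η
  have hm := tensorCoeff_minus hη hl (j := j) (i + 1) (j - i)
  rw [show (j : ℤ) - i + (i + 1) = j + 1 by ring, cminus_top, zero_mul, add_sub_cancel_right,
    show (j : ℤ) - i - 1 = j - (i + 1) by ring] at hm
  have hs := neg_one_zpow_mul_self ((i : ℤ) + 1)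
  have c1 := cminus_sq hη (l := l) (m := i + 1) (by omega) (by omega)
  have c2 := cminus_sq hη (l := j) (m := j - i) (by omega) (by omega)
  have n1 := qnum_eq_gaussNum (η := η) (l + i + 1)
  have n2 := qnum_eq_gaussNum (η := η) (l - i)
  have n3 := qnum_eq_gaussNum (η := η) (2 * j - i)
  have n4 := qnum_eq_gaussNum (η := η) (i + 1)
  rw [show (((l + i + 1 : ℕ) : ℤ)) = l + (i + 1) by push_cast; ring] at n1
  rw [show (((l - i : ℕ) : ℤ)) = l - (i + 1) + 1 by omega] at n2
  rw [show (((2 * j - i : ℕ) : ℤ)) = j + (j - i) by omega] at n3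
  rw [show (((i + 1 : ℕ) : ℤ)) = j - (j - i) + 1 by push_cast; ring] at n4
  rw [n1, n2] at c1
  rw [n3, n4] at c2
  have r2 : ((l - i : ℕ) : ℝ) = l - i := by rw [Nat.cast_sub hi.le]
  have r3 : ((2 * j - i : ℕ) : ℝ) = 2 * j - i := by rw [Nat.cast_sub (by omega)]; push_cast; rfl
  have hpow : (-q η) ^ (2 * j - l + 1) = -q η ^ (2 * (j : ℝ) - l + 1) := by
    rw [Odd.neg_pow, ← Real.rpow_natCast]
    · push_cast [Nat.cast_sub hlj]; rfl
    · exact (Nat.even_sub hlj |>.2 (by simp [hl])).add_one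
  set A := q η ^ (-(((i + 1 : ℤ) : ℝ)) / 2) with hA
  set B := q η ^ (((j - i : ℤ) : ℝ) / 2) with hB
  set x := tensorCoeff η l j i (j - i)
  set y := tensorCoeff η l j (i + 1) (j - (i + 1))
  set s := (-1 : ℝ) ^ ((i : ℤ) + 1)
  have hsq : B ^ 2 * cminus η l (i + 1) ^ 2 * x ^ 2 = A ^ 2 * cminus η j (j - i) ^ 2 * y ^ 2 := by
    have h1 : B * cminus η l (i + 1) * x = -(s * A * cminus η j (j - i) * y) := by
      linear_combination -hm
    calc B ^ 2 * cminus η l (i + 1) ^ 2 * x ^ 2 = (B * cminus η l (i + 1) * x) ^ 2 := by ring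
      _ = (s * s) * (A ^ 2 * cminus η j (j - i) ^ 2 * y ^ 2) := by rw [h1]; ring
      _ = _ := by rw [hs, one_mul]
  rw [c1, c2, pow_two A, pow_two B, hA, hB] at hsq
  have hg := gam_ne_zero hη
  rw [hpow]
  set X := q η ^ (-(((l + i + 1 : ℕ) : ℝ) - 1) / 2) with hX
  set Y := q η ^ (-(((l - i : ℕ) : ℝ) - 1) / 2) with hY
  set Z := q η ^ (-(((2 * j - i : ℕ) : ℝ) - 1) / 2) with hZ
  set W := q η ^ (-(((i + 1 : ℕ) : ℝ) - 1) / 2) with hW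
  have hexp : B * B * X * Y = q η ^ (2 * (j : ℝ) - l + 1) * (A * A * Z * W) := by
    rw [hA, hB, hX, hY, hZ, hW]
    simp only [← Real.rpow_add hq]
    congr 1
    rw [r2, r3]
    push_cast
    ring
  have hne : A * A * Z * W * gam η ≠ 0 := by
    have : 0 < A * A * Z * W := by positivity
    exact mul_ne_zero this.ne' hg
  refine mul_left_cancel₀ hne ?_
  linear_combination (gaussNum (-q η) (l + i + 1) * gaussNum (-q η) (l - i) * x ^ 2 * gam η) * hexp
    - hsq

/-- The solution of the recursion `tensorCoeff_highest`, in the form of the terms of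
`sum_gaussBinom`. -/
lemma tensorCoeff_highest_sq (hη : η ≠ 0) (hl : Even l) (hlj : l ≤ 2 * j) (k i : ℕ)
    (hki : k + i = l) :
    (-1) ^ i * tensorCoeff η l j i (j - i) ^ 2 *
        ((-q η) ^ ((2 * j - l + 1) * l) * gaussBinom (-q η) l l) =
      tensorCoeff η l j l (j - l) ^ 2 * ((-q η) ^ ((2 * j - l + 1) * i) *
        gaussBinom (-q η) (2 * j - l) k * gaussBinom (-q η) l i) := by
  have hQ := gaussNum_neg_q_ne_zero hη
  induction k generalizing i with
  | zero =>
    obtain rfl : i = l := by omega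
    rw [gaussBinom_zero_right hQ, hl.neg_one_pow]
    ring
  | succ k ih =>
    have h := ih (i + 1) (by omega)
    have hr := tensorCoeff_highest hη hl hlj (i := i) (by omega)
    have b1 := gaussBinom_succ_right hQ (2 * j - l) k
    have b2 := gaussBinom_succ_right hQ l i
    rw [show 2 * j - l + k + 1 = 2 * j - i by omega] at b1
    rw [show l - i = k + 1 by omega] at hr
    have hne : (-q η) ^ (2 * j - l + 1) *
        (gaussNum (-q η) (l + i + 1) * gaussNum (-q η) (k + 1)) ≠ 0 :=
      mul_ne_zero (pow_ne_zero _ (neg_ne_zero.2 (q_pos η).ne')) (mul_ne_zero (hQ _) (hQ _))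
    push_cast at h
    refine mul_left_cancel₀ hne ?_
    rw [mul_add, mul_one, pow_add, pow_succ] at h
    set T := (-q η) ^ (2 * j - l + 1)
    set R := (-q η) ^ ((2 * j - l + 1) * l) * gaussBinom (-q η) l l
    set P := (-q η) ^ ((2 * j - l + 1) * i)
    set t₀ := tensorCoeff η l j l (j - l)
    linear_combination ((-1) ^ i * R) * hr
      + (gaussNum (-q η) (2 * j - i) * gaussNum (-q η) (i + 1)) * h
      - (t₀ ^ 2 * P * T * gaussNum (-q η) (l + i + 1) * gaussBinom (-q η) l i) * b1
      + (t₀ ^ 2 * P * T * gaussNum (-q η) (2 * j - i) * gaussBinom (-q η) (2 * j - l) k) * b2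

/-- The sum over `p` of the squares of the matrix elements of `t^l_p` between `e_(m-p)` and `e_m`,
with the signs of the indefinite form on `V^l ⊗ V^j`; here `p = l - k`. -/
def normSum (η : ℝ) (l j : ℕ) (m : ℤ) : ℝ :=
  ∑ k ∈ Finset.range (2 * l + 1),
    (-1) ^ (((l : ℤ) - k) * (j - m + 1)) * tensorCoeff η l j (l - k) (m - (l - k)) ^ 2

lemma normSum_top (hη : η ≠ 0) (hl : Even l) (hlj : l ≤ 2 * j) :
    normSum η l j j = alpha η l j ^ 2 := by
  have hQ := gaussNum_neg_q_ne_zero hη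
  have hne : (-q η) ^ ((2 * j - l + 1) * l) * gaussBinom (-q η) l l ≠ 0 :=
    mul_ne_zero (pow_ne_zero _ (neg_ne_zero.2 (q_pos η).ne'))
      (div_ne_zero (gaussFact_ne_zero hQ _)
        (mul_ne_zero (gaussFact_ne_zero hQ _) (gaussFact_ne_zero hQ _)))
  refine mul_right_cancel₀ hne ?_
  rw [alpha_sq_eq hη hl hlj, show 2 * j + 1 = 2 * j - l + l + 1 by omega, ← sum_gaussBinom hQ,
    Finset.mul_sum, normSum, Finset.sum_mul,
    ← Finset.sum_subset (s₁ := Finset.range (l + 1)) (Finset.range_mono (by omega)),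
    ← Finset.sum_range_reflect]
  · refine Finset.sum_congr rfl fun i hi => ?_
    have hi' := Finset.mem_range.1 hi
    have h := tensorCoeff_highest_sq hη hl hlj (l - i) i (by omega)
    rw [← h, show (l : ℤ) - ((l + 1 - 1 - i : ℕ) : ℤ) = i by omega, sub_self, zero_add, mul_one,
      zpow_natCast]
  -- For `p = l - k < 0` the weight `j - p` is out of range.
  · intro k _ hk
    rw [Finset.mem_range] at hk
    rw [tensorCoeff_of_not_mem]
    · ring
    · simp only [Set.mem_Icc]; omega

/-- The normalization sums of neighbouring weights agree: `v₊` and `v₋` are adjoint to each other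
up to signs, so the difference of the two sums telescopes. -/
lemma normSum_sub_one (hη : η ≠ 0) (hl : Even l) {m : ℤ} (h1 : -(j : ℤ) < m) (h2 : m ≤ j) :
    normSum η l j (m - 1) = normSum η l j m := by
  -- The terms with `t^l_(p-1)` and `t^l_p`, which the two recursions have in common up to a shift.
  let F : ℤ → ℝ := fun p => (-1) ^ (p * (j - m + 1)) * q η ^ (((m - p : ℤ) : ℝ) / 2) *
    cminus η l p * tensorCoeff η l j (p - 1) (m - p) * tensorCoeff η l j p (m - p)
  have key : ∀ p : ℤ, cminus η j m * ((-1) ^ (p * (j - m + 1)) * tensorCoeff η l j p (m - p) ^ 2)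
      - cminus η j m * ((-1) ^ (p * (j - (m - 1) + 1)) * tensorCoeff η l j p (m - 1 - p) ^ 2)
      = F p - F (p + 1) := by
    intro p
    have hM := tensorCoeff_minus hη hl (j := j) p (m - p)
    have hP := tensorCoeff_plus hη hl (j := j) p (m - 1 - p)
    have hc := cminus_eq η j m
    have hc1 := cplus_eq η j (m - 1 - p)
    have hc2 := cplus_eq η l p
    have s1 : (-1 : ℝ) ^ (p * ((j : ℤ) - (m - 1) + 1)) =
        (-1) ^ (p * ((j : ℤ) - m + 1)) * (-1) ^ p := by
      rw [← neg_one_zpow_add]; congr 1; ring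
    have s2 : (-1 : ℝ) ^ ((p + 1) * ((j : ℤ) - m + 1)) =
        (-1) ^ (p * ((j : ℤ) - m + 1)) * (-1) ^ ((j : ℤ) - m + 1) := by
      rw [← neg_one_zpow_add]; congr 1; ring
    have s3 : (-1 : ℝ) ^ ((j : ℤ) - (m - 1 - p)) = (-1) ^ ((j : ℤ) - m + 1) * (-1) ^ p := by
      rw [← neg_one_zpow_add]; congr 1; ring
    have s4 : (-1 : ℝ) ^ ((l : ℤ) - p) = (-1) ^ p := by
      rw [neg_one_zpow_sub, zpow_natCast, hl.neg_one_pow, one_mul]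
    rw [s3, show m - 1 - p + 1 = m - p by ring] at hc1
    rw [s4] at hc2
    rw [sub_add_cancel, show m - p - 1 = m - 1 - p by ring] at hM
    rw [sub_add_cancel, hc1, hc2, show m - 1 - p + 1 = m - p by ring] at hP
    simp only [F]
    rw [s1, s2, show m - (p + 1) = m - 1 - p by ring, add_sub_cancel_right]
    have e1 := neg_one_zpow_mul_self p
    have e2 := neg_one_zpow_mul_self ((j : ℤ) - m + 1)
    rcases mul_self_eq_one_iff.1 e1 with e1 | e1 <;> rcases mul_self_eq_one_iff.1 e2 with e2 | e2
    all_goals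
      rw [e1] at hM hP ⊢
      rw [e2] at hP hc ⊢
      set σ := (-1 : ℝ) ^ (p * ((j : ℤ) - m + 1))
      set x := tensorCoeff η l j p (m - p)
      set y := tensorCoeff η l j p (m - 1 - p)
    · linear_combination (σ * x) * hM - (σ * y) * hP - (σ * y ^ 2) * hc
    · linear_combination (σ * x) * hM + (σ * y) * hP - (σ * y ^ 2) * hc
    · linear_combination (σ * x) * hM + (σ * y) * hP + (σ * y ^ 2) * hc
    · linear_combination (σ * x) * hM - (σ * y) * hP + (σ * y ^ 2) * hc
  have hc := (cminus_pos hη h1 h2).ne'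
  refine mul_left_cancel₀ hc ?_
  rw [eq_comm, ← sub_eq_zero, normSum, normSum, Finset.mul_sum, Finset.mul_sum,
    ← Finset.sum_sub_distrib]
  have tel : ∀ k : ℕ, F (l - k) - F (l - k + 1) =
      F (l - (k + 1 : ℕ) + 1) - F (l - k + 1) := by
    intro k
    rw [show (l : ℤ) - (k + 1 : ℕ) + 1 = l - k by push_cast; ring]
  simp only [key, tel]
  rw [Finset.sum_range_sub fun k : ℕ => F (l - k + 1)]
  simp only [F]
  rw [show (l : ℤ) - (2 * l + 1 : ℕ) + 1 = -l by push_cast; ring,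
    show (l : ℤ) - (0 : ℕ) + 1 = l + 1 by simp, cminus_bot, cminus_top]
  ring

lemma normSum_eq (hη : η ≠ 0) (hl : Even l) (hlj : l ≤ 2 * j) (m : Weight j) :
    normSum η l j m = alpha η l j ^ 2 := by
  have key : ∀ k : ℕ, k ≤ 2 * j → normSum η l j (j - k) = alpha η l j ^ 2 := by
    intro k
    induction k with
    | zero => intro _; simpa using normSum_top hη hl hlj
    | succ k ih =>
      intro hk
      rw [show (j : ℤ) - (k + 1 : ℕ) = j - k - 1 by push_cast; ring,
        normSum_sub_one hη hl (by omega) (by omega), ih (by omega)]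
  have hm := m.2
  rw [Set.mem_Icc] at hm
  have := key (j - m : ℤ).toNat (by omega)
  rwa [show (j : ℤ) - ((j - m : ℤ).toNat : ℕ) = m by omega] at this

end

/-! ### The Clebsch-Gordan coefficients from the tensor operator -/

section

variable {η : ℝ} {l j : ℕ}

lemma alpha_eq (η : ℝ) (l j : ℕ) : alpha η l j = (-1) ^ (l * (l + 1) / 2) *
    (q η ^ (-((l : ℝ) * (l + 1)) / 4) * (|qfact η l| *
    √(qfact η (2 * j + l + 1) * gam η ^ l /
      (qfact η (2 * l) * qfact η (2 * j - l) * qnum η (2 * j + 1))))) := by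
  rw [alpha, mul_assoc, mul_assoc]

lemma tensorCoeff_top_eq (hlj : l ≤ 2 * j) : tensorCoeff η l j l (j - l) =
    (-1) ^ (l * (l + 1) / 2) * ((∏ i ∈ Finset.range l, cminus η j (j - l + i + 1)) *
      q η ^ ((l : ℝ) * (j - l) / 2)) := by
  have hs : ∀ n : ℕ, ∏ i ∈ Finset.range n, (-1 : ℝ) ^ ((n : ℤ) - i) = (-1) ^ (n * (n + 1) / 2) := by
    intro n
    induction n with
    | zero => simp
    | succ n ih =>
      rw [Finset.prod_range_succ', show (n + 1) * (n + 1 + 1) = n * (n + 1) + 2 * (n + 1) by ring,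
        Nat.add_mul_div_left _ _ two_pos, pow_add, ← ih]
      congr 1
      · refine Finset.prod_congr rfl fun i _ => ?_
        rw [Nat.cast_succ, Nat.cast_succ, add_sub_add_right_eq_sub]
  rw [tensorCoeff_top hlj]
  simp only [cplus_eq]
  rw [Finset.prod_mul_distrib, ← mul_assoc, ← hs]
  congr 2
  refine Finset.prod_congr rfl fun i _ => ?_
  congr 1
  ring

lemma tensorCoeff_top_div_alpha_pos (hη : η ≠ 0) (hl : Even l) (hlj : l ≤ 2 * j) :
    0 < tensorCoeff η l j l (j - l) / alpha η l j := by
  rw [tensorCoeff_top_eq hlj, alpha_eq,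
    mul_div_mul_left _ _ (pow_ne_zero _ (by norm_num : (-1 : ℝ) ≠ 0))]
  have hprod : 0 < ∏ i ∈ Finset.range l, cminus η j (j - l + i + 1) :=
    Finset.prod_pos fun i hi => by
      have := Finset.mem_range.1 hi
      exact cminus_pos hη (by omega) (by omega)
  have hX := Real.sqrt_pos.2 (alpha_radicand_pos hη hl hlj)
  have hf := abs_pos.2 (qfact_ne_zero hη l)
  have h1 := Real.rpow_pos_of_pos (q_pos η) ((l : ℝ) * (j - l) / 2)
  have h2 := Real.rpow_pos_of_pos (q_pos η) (-((l : ℝ) * (l + 1)) / 4)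
  exact div_pos (mul_pos hprod h1) (mul_pos h2 (mul_pos hf hX))

lemma alpha_ne_zero (hη : η ≠ 0) (hl : Even l) (hlj : l ≤ 2 * j) : alpha η l j ≠ 0 := fun h => by
  have := tensorCoeff_top_div_alpha_pos hη hl hlj
  rw [h, div_zero] at this
  exact this.false

lemma esign_zero (hl : Even l) (p : ℤ) : esign l 0 p = (-1) ^ p := by
  have hl' : ((l : ℤ) : ZMod 2) = 0 := by
    rw [ZMod.intCast_zmod_eq_zero_iff_dvd]
    exact_mod_cast even_iff_two_dvd.1 hl
  have key : deg l 0 p = 0 ↔ Even p := by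
    rw [deg, add_zero, Int.cast_sub, hl', zero_sub, neg_eq_zero,
      ZMod.intCast_zmod_eq_zero_iff_dvd, even_iff_two_dvd]
    rfl
  rw [esign]
  rcases Int.even_or_odd p with h | h
  · rw [if_pos (key.2 h), h.neg_one_zpow]
  · rw [if_neg (fun h0 => Int.not_even_iff_odd.2 h (key.1 h0)), h.neg_one_zpow]

/-- The candidate for the Clebsch-Gordan coefficients: the matrix elements of the tensor operator,
up to signs and the reduced matrix element. The signs turn the intertwiner
`V^l ⊗ V^j → V^j` into its transpose. -/
def tensorCG (η : ℝ) (l j : ℕ) (p n m : ℤ) : ℝ :=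
  if p + n = m then (-1) ^ (p * (j - n)) * (tensorCoeff η l j p n / alpha η l j) else 0

lemma tensorCG_of_eq {p n m : ℤ} (h : p + n = m) : tensorCG η l j p n m =
    (-1) ^ (p * (j - n)) * (tensorCoeff η l j p n / alpha η l j) := if_pos h

lemma tensorCG_of_ne {p n m : ℤ} (h : p + n ≠ m) : tensorCG η l j p n m = 0 := if_neg h

lemma isStandard_tensorCG (hη : η ≠ 0) (hl : Even l) :
    IsStandard η l 0 j j (tensorCG η l j) where
  supp p n m h := by
    by_cases hm : p + n = m
    · rw [tensorCG_of_eq hm, tensorCoeff_of_not_mem]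
      · ring
      · rwa [add_comm n, hm]
    · exact tensorCG_of_ne hm
  weight p n m h := tensorCG_of_ne h
  plus p n m := by
    by_cases hm : p + n = m + 1
    swap
    · rw [tensorCG_of_ne hm, tensorCG_of_ne (by omega), tensorCG_of_ne (by omega)]
      ring
    obtain rfl : m = n + p - 1 := by omega
    have hM := tensorCoeff_minus hη hl (j := j) p n
    have hc := cplus_eq η l (p - 1)
    have hc1 := cplus_eq η j (n - 1)
    have hc2 := cplus_eq η j (n + p - 1)
    have s1 : (-1 : ℝ) ^ ((l : ℤ) - (p - 1)) = -(-1) ^ p := by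
      rw [neg_one_zpow_sub, zpow_natCast, hl.neg_one_pow, neg_one_zpow_sub]; simp
    have s2 : (-1 : ℝ) ^ ((j : ℤ) - (n - 1)) = -(-1) ^ ((j : ℤ) - n) := by
      rw [← sub_add, neg_one_zpow_add]; simp
    have s3 : (-1 : ℝ) ^ ((j : ℤ) - (n + p - 1)) = -((-1) ^ ((j : ℤ) - n) * (-1) ^ p) := by
      rw [← neg_one_zpow_sub, show (j : ℤ) - (n + p - 1) = j - n - p + 1 by ring,
        neg_one_zpow_add]
      simp
    have s4 : (-1 : ℝ) ^ ((p - 1) * ((j : ℤ) - n)) =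
        (-1) ^ (p * ((j : ℤ) - n)) * (-1) ^ ((j : ℤ) - n) := by
      rw [← neg_one_zpow_sub]; congr 1; ring
    have s5 : (-1 : ℝ) ^ (p * ((j : ℤ) - (n - 1))) = (-1) ^ (p * ((j : ℤ) - n)) * (-1) ^ p := by
      rw [← neg_one_zpow_add]; congr 1; ring
    rw [sub_add_cancel] at hc hc1 hc2
    rw [tensorCG_of_eq (by ring), tensorCG_of_eq (by ring), tensorCG_of_eq (by ring),
      esign_zero hl, hc, hc1, hc2, s1, s2, s3, s4, s5, ← neg_div]
    have e1 := neg_one_zpow_mul_self p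
    set σ := (-1 : ℝ) ^ (p * ((j : ℤ) - n))
    set ε := (-1 : ℝ) ^ p
    set κ := (-1 : ℝ) ^ ((j : ℤ) - n)
    rw [div_eq_mul_inv _ (alpha η l j), div_eq_mul_inv _ (alpha η l j),
      div_eq_mul_inv _ (alpha η l j)]
    linear_combination (ε * κ * σ * (alpha η l j)⁻¹) * hM
  minus p n m := by
    by_cases hm : p + n = m - 1
    swap
    · rw [tensorCG_of_ne hm, tensorCG_of_ne (by omega), tensorCG_of_ne (by omega)]
      ring
    obtain rfl : m = n + p + 1 := by omega
    have hP := tensorCoeff_plus hη hl (j := j) p n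
    have hc := cplus_eq η l p
    have hc1 := cplus_eq η j n
    have hc2 := cplus_eq η j (n + p)
    have s1 : (-1 : ℝ) ^ ((l : ℤ) - p) = (-1) ^ p := by
      rw [neg_one_zpow_sub, zpow_natCast, hl.neg_one_pow, one_mul]
    have s3 : (-1 : ℝ) ^ ((j : ℤ) - (n + p)) = (-1) ^ ((j : ℤ) - n) * (-1) ^ p := by
      rw [← neg_one_zpow_sub]; congr 1; ring
    have s4 : (-1 : ℝ) ^ ((p + 1) * ((j : ℤ) - n)) =
        (-1) ^ (p * ((j : ℤ) - n)) * (-1) ^ ((j : ℤ) - n) := by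
      rw [← neg_one_zpow_add]; congr 1; ring
    have s5 : (-1 : ℝ) ^ (p * ((j : ℤ) - (n + 1))) = (-1) ^ (p * ((j : ℤ) - n)) * (-1) ^ p := by
      rw [← neg_one_zpow_sub]; congr 1; ring
    rw [s1] at hc
    rw [s3] at hc2
    rw [hc, hc1, hc2] at hP
    rw [tensorCG_of_eq (by ring), tensorCG_of_eq (by ring), tensorCG_of_eq (by ring),
      esign_zero hl, s4, s5, ← neg_div]
    have e1 := neg_one_zpow_mul_self p
    have e2 := neg_one_zpow_mul_self ((j : ℤ) - n)
    set σ := (-1 : ℝ) ^ (p * ((j : ℤ) - n))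
    set ε := (-1 : ℝ) ^ p
    set κ := (-1 : ℝ) ^ ((j : ℤ) - n)
    rw [div_eq_mul_inv _ (alpha η l j), div_eq_mul_inv _ (alpha η l j),
      div_eq_mul_inv _ (alpha η l j)]
    rcases mul_self_eq_one_iff.1 e1 with e1 | e1 <;> rcases mul_self_eq_one_iff.1 e2 with e2 | e2
    all_goals rw [e1, e2] at hP ⊢
    · linear_combination (-(σ * (alpha η l j)⁻¹)) * hP
    · linear_combination (σ * (alpha η l j)⁻¹) * hP
    · linear_combination (σ * (alpha η l j)⁻¹) * hP
    · linear_combination (-(σ * (alpha η l j)⁻¹)) * hP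

lemma extendZero_restrict {l₁ l₂ l : ℕ} {A : ℤ → ℤ → ℤ → ℝ}
    (hA : ∀ p n m, ¬ (p ∈ Set.Icc (-(l₁ : ℤ)) l₁ ∧ n ∈ Set.Icc (-(l₂ : ℤ)) l₂ ∧
      m ∈ Set.Icc (-(l : ℤ)) l) → A p n m = 0) :
    extendZero (fun (p : Weight l₁) (n : Weight l₂) (m : Weight l) => A p n m) = A := by
  funext p n m
  by_cases h : p ∈ Set.Icc (-(l₁ : ℤ)) l₁ ∧ n ∈ Set.Icc (-(l₂ : ℤ)) l₂ ∧
      m ∈ Set.Icc (-(l : ℤ)) l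
  · rw [extendZero, dif_pos h]
  · rw [extendZero_of_not_mem _ h, hA p n m h]

/-- A sum over the weights of `V^l`, taken from the highest weight downwards. -/
lemma sum_weight (l : ℕ) (f : ℤ → ℝ) :
    ∑ p : Weight l, f p = ∑ k ∈ Finset.range (2 * l + 1), f (l - k) := by
  refine Finset.sum_bij' (fun p _ => (l - p : ℤ).toNat)
    (fun k hk => ⟨l - k, by have := Finset.mem_range.1 hk; rw [Set.mem_Icc]; omega⟩) ?_ ?_ ?_ ?_ ?_
  · rintro ⟨p, hp⟩ _
    rw [Set.mem_Icc] at hp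
    rw [Finset.mem_range]
    simp only
    omega
  · intros; exact Finset.mem_univ _
  · rintro ⟨p, hp⟩ _
    rw [Set.mem_Icc] at hp
    refine Subtype.ext ?_
    simp only
    omega
  · intro k hk
    simp
  · rintro ⟨p, hp⟩ _
    rw [Set.mem_Icc] at hp
    simp only
    congr 1
    omega

lemma neg_one_zpow_sub_mul (hl : Even l) (p x : ℤ) :
    (-1 : ℝ) ^ (((l : ℤ) - p) * x) = (-1) ^ (p * x) := by
  rw [zpow_mul, neg_one_zpow_sub, zpow_natCast, hl.neg_one_pow, one_mul, ← zpow_mul]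

lemma neg_one_zpow_mul_even (hl : Even l) (x : ℤ) :
    (-1 : ℝ) ^ (x * ((l : ℤ) + j + j)) = 1 := by
  refine Even.neg_one_zpow (Even.mul_left ?_ _)
  rw [add_assoc]
  exact ((Int.even_coe_nat l).2 hl).add (Even.add_self _)

lemma isClebschGordan_tensorCG (hη : η ≠ 0) (hl : Even l) (hlj : l ≤ 2 * j) (lam : ZMod 2) :
    IsClebschGordan η l 0 j lam j lam (fun p n m => tensorCG η l j p n m) where
  standard := isStandard_extendZero_iff.1 (by
    rw [extendZero_restrict (isStandard_tensorCG hη hl).supp]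
    exact isStandard_tensorCG hη hl)
  homogeneous p n m h := by
    have hm : (p : ℤ) + n = m := by
      by_contra h0
      exact h (tensorCG_of_ne h0)
    have hl' : ((l : ℤ) : ZMod 2) = 0 := by
      rw [ZMod.intCast_zmod_eq_zero_iff_dvd]
      exact_mod_cast even_iff_two_dvd.1 hl
    rw [deg, deg, deg, ← hm]
    simp only [Int.cast_sub, Int.cast_add, hl']
    ring
  orthogonal m m' := by
    rw [neg_one_zpow_mul_even hl]
    by_cases hmm : m = m'
    swap
    · rw [if_neg hmm]
      refine Finset.sum_eq_zero fun p _ => Finset.sum_eq_zero fun n _ => ?_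
      by_cases h : (p : ℤ) + n = m
      · rw [tensorCG_of_ne (m := m') (fun h' => hmm (Subtype.ext (h.symm.trans h'))), mul_zero,
          mul_zero]
      · rw [tensorCG_of_ne h, zero_mul, mul_zero]
    subst hmm
    rw [if_pos rfl]
    let G : ℤ → ℝ := fun p =>
      (-1) ^ (p * ((j : ℤ) - m + 1)) * tensorCoeff η l j p (m - p) ^ 2 / alpha η l j ^ 2
    have inner : ∀ p : Weight l, ∑ n : Weight j, (-1 : ℝ) ^ (((l : ℤ) - p) * ((j : ℤ) - n)) *
        (tensorCG η l j p n m * tensorCG η l j p n m) =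
        G p := by
      intro p
      simp only [G]
      by_cases hn : (m : ℤ) - p ∈ Set.Icc (-(j : ℤ)) j
      · rw [Finset.sum_eq_single ⟨m - p, hn⟩]
        · have hs : (-1 : ℝ) ^ ((p : ℤ) * ((j : ℤ) - (m - p))) =
              (-1) ^ ((p : ℤ) * ((j : ℤ) - m + 1)) := by
            rw [show (p : ℤ) * ((j : ℤ) - (m - p)) = p * (j - m + 1) + p * (p - 1) by ring,
              neg_one_zpow_add, (Int.even_mul_pred_self _).neg_one_zpow, mul_one]
          rw [neg_one_zpow_sub_mul hl, tensorCG_of_eq (by simp)]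
          simp only
          rw [hs]
          have := neg_one_zpow_mul_self ((p : ℤ) * ((j : ℤ) - m + 1))
          linear_combination ((-1) ^ ((p : ℤ) * ((j : ℤ) - m + 1)) *
            (tensorCoeff η l j p (m - p) / alpha η l j) ^ 2) * this
        · intro n _ hne
          rw [tensorCG_of_ne (fun h => hne (Subtype.ext (by simp only; omega)))]
          ring
        · simp
      · rw [tensorCoeff_of_not_mem (fun h => hn h.2.1)]
        rw [Finset.sum_eq_zero, zero_pow two_ne_zero, mul_zero, zero_div]
        intro n _
        rw [tensorCG_of_ne (fun h => hn (by rw [← h, add_sub_cancel_left]; exact n.2))]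
        ring
    rw [Finset.sum_congr rfl fun p _ => inner p, sum_weight l G]
    simp only [G]
    rw [← Finset.sum_div]
    have := normSum_eq hη hl hlj m
    rw [normSum] at this
    rw [this, div_self (pow_ne_zero _ (alpha_ne_zero hη hl hlj))]
  phase p n m hp hm hpn := by
    have hn : (n : ℤ) = j - l := by omega
    rw [tensorCG_of_eq hpn, hp, hn, (((Int.even_coe_nat l).2 hl).mul_right _).neg_one_zpow, one_mul]
    exact tensorCoeff_top_div_alpha_pos hη hl hlj

end

end UqOsp
end

theorem theorem2 (η : ℝ) (hη : η ≠ 0) (l j : ℕ) (hl : Even l) (hlj : l ≤ 2 * j) (lam : ZMod 2)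
    (p : UqOsp.Weight l) (m n : UqOsp.Weight j) :
    LinearMap.toMatrix' (UqOsp.rep η j (UqOsp.t η l p)) m n =
      ((UqOsp.alpha η l j * UqOsp.modifiedCG η l p 0 j n lam j m lam : ℝ) : ℂ) := by
  rw [UqOsp.toMatrix_rep_t hη hl, UqOsp.modifiedCG,
    (UqOsp.isClebschGordan_tensorCG hη hl hlj lam).clebschGordan_eq hη,
    UqOsp.neg_one_zpow_mul_even hl, UqOsp.neg_one_zpow_sub_mul hl, mul_one]
  congr 1
  beta_reduce
  by_cases h : (n : ℤ) + p = m
  · have hα := UqOsp.alpha_ne_zero hη hl hlj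
    have hs := UqOsp.neg_one_zpow_mul_self ((p : ℤ) * ((j : ℤ) - n))
    rw [if_pos h, UqOsp.tensorCG_of_eq (by omega), ← mul_assoc ((-1 : ℝ) ^ _), hs, one_mul,
      mul_div_cancel₀ _ hα]
  · rw [if_neg h, UqOsp.tensorCG_of_ne (by omega), mul_zero, mul_zero]
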